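/- Let $n\ge 1$, $\alpha\ge 0$, and let $w:\mathbb R^n\to[0,\infty)$ be such that $\Sigma:=\{x: w(x)>0\}$ is a nonempty open convex cone with vertex at the origin, $\log w$ is concave on $\Sigma$, and $w(tx)=t^{\alpha}w(x)$ for all $t>0$, $x\in\Sigma$. Put $d\nu=w\,dx$ on $\Sigma$, $C_w=\big(\int_\Sigma w(x)e^{-|x|^2/2}\,dx\big)^{-1}$ and $d\mu_w=C_w\,w(x)e^{-|x|^2/2}\,dx$ on $\Sigma$. Let $A$ be the set of restrictions to $\overline\Sigma$ of functions $u\in C_c^\infty(\mathbb R^n)$ with $\nabla u\cdot\eta=0$ on $\partial\Sigma$ ($\eta$ the outward normal), and let $W^{1,2}_A(\Sigma,\mu_w)$ be the completion of $A$ under the norm $\big(\int_\Sigma |u|^2d\mu_w\big)^{1/2}+\big(\int_\Sigma|\nabla u|^2d\mu_w\big)^{1/2}$. Write $\mathrm{Ent}_\nu(\varphi)=\int_\Sigma\varphi\log\varphi\,d\nu-\big(\int_\Sigma\varphi\,d\nu\big)\log\big(\int_\Sigma\varphi\,d\nu\big)$. Then for every $f\in W^{1,2}_A(\Sigma,\mu_w)$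 with $\int_\Sigma f^2\,d\nu<\infty$ and $\int_\Sigma|\nabla f|^2\,d\nu<\infty$, the integral $\int_\Sigma f^2\log f^2\,d\nu$ is well defined in $[-\infty,\infty)$ and $$\mathrm{Ent}_{\nu}(f^2)\le\frac{n+\alpha}{2}\int_\Sigma f^2\,d\nu\;\log\!\left(C\,\frac{\int_\Sigma|\nabla f|^2\,d\nu}{\int_\Sigma f^2\,d\nu}\right),\qquad C=C_{\mathrm{LSIH}}:=\frac{4\,C_w^{2/(n+\alpha)}}{e\,(n+\alpha)}$$ (for $f=0$ both sides are read as $0$). The constant is sharp: $C_{\mathrm{LSIH}}$ is the smallest $C>0$ for which the inequality holds for all such $f$. Moreover, for every $a\in\mathbb R$ the Gaussian $f(x)=a\,e^{-|x|^2/4}$ belongs to this class of functions and gives equality with $C=C_{\mathrm{LSIH}}$. -/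

import Mathlib

open MeasureTheory Filter
open scoped Topology ENNReal ContDiff

noncomputable section

namespace WeightedLSI

variable {n : ℕ}

/-- The positivity set `Σ = {w > 0}` of the weight. -/
def support (w : EuclideanSpace ℝ (Fin n) → ℝ) : Set (EuclideanSpace ℝ (Fin n)) :=
  {x | 0 < w x}

/-- `w : ℝⁿ → [0, ∞)` is log-concave and homogeneous of degree `α ≥ 0`, and `Σ = {w > 0}` is a
nonempty open convex cone with vertex at the origin. Convexity of `Σ` is part of `ConcaveOn`,
and `Σ` is stable under positive dilations by homogeneity. -/
structure IsHomogeneousLogConcave (α : ℝ) (w : EuclideanSpace ℝ (Fin n) → ℝ) : Prop where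
  nonneg : ∀ x, 0 ≤ w x
  isOpen_support : IsOpen (support w)
  nonempty_support : (support w).Nonempty
  logConcave : ConcaveOn ℝ (support w) (fun x => Real.log (w x))
  degree_nonneg : 0 ≤ α
  homogeneous : ∀ t : ℝ, 0 < t → ∀ x ∈ support w, w (t • x) = t ^ α * w x

/-- The measure `dν = w dx` on `Σ`. -/
def nu (w : EuclideanSpace ℝ (Fin n) → ℝ) : Measure (EuclideanSpace ℝ (Fin n)) :=
  (volume.restrict (support w)).withDensity (fun x => ENNReal.ofReal (w x))

/-- The constant `C_w = (∫_Σ w(x) e^{-|x|²/2} dx)⁻¹`. -/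
def normConst (w : EuclideanSpace ℝ (Fin n) → ℝ) : ℝ :=
  (∫ x in support w, w x * Real.exp (-‖x‖ ^ 2 / 2))⁻¹

/-- The weighted Gaussian probability measure `dμ_w = C_w w(x) e^{-|x|²/2} dx` on `Σ`. -/
def mu (w : EuclideanSpace ℝ (Fin n) → ℝ) : Measure (EuclideanSpace ℝ (Fin n)) :=
  (volume.restrict (support w)).withDensity
    (fun x => ENNReal.ofReal (normConst w * (w x * Real.exp (-‖x‖ ^ 2 / 2))))

/-- `η` is an outward normal vector of the convex set `S` at `x`. -/
def IsOutwardNormal (S : Set (EuclideanSpace ℝ (Fin n))) (x η : EuclideanSpace ℝ (Fin n)) :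
    Prop :=
  ∀ y ∈ S, inner ℝ η (y - x) ≤ 0

/-- The class `A` of all `u ∈ C_0^∞(closure Σ)` (restrictions of smooth compactly supported
functions on `ℝⁿ`; they need not vanish on `∂Σ`) with `∇u · η = 0` on `∂Σ`. The condition is
imposed for every outward normal. As `∇u` is continuous and the normal cone of an open convex set
at a boundary point is generated by limits of the unit normals at nearby regular boundary points,
this is the same as imposing it at the regular boundary points only. -/
def IsTestFunction (w : EuclideanSpace ℝ (Fin n) → ℝ) (u : EuclideanSpace ℝ (Fin n) → ℝ) : Prop :=
  ContDiff ℝ ∞ u ∧ HasCompactSupport u ∧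
    ∀ x ∈ frontier (support w), ∀ η, IsOutwardNormal (support w) x η →
      inner ℝ (gradient u x) η = 0

/-- `f` belongs to `W^{1,2}_A(Σ, μ_w)`, with gradient `g`. The completion of `A` under
`‖u‖_{L²(μ_w)} + ‖∇u‖_{L²(μ_w)}` is realized as the closure of the graph `{(u, ∇u) : u ∈ A}` in
`L²(μ_w) × L²(μ_w; ℝⁿ)`. For the weights considered `w` is locally bounded below on `Σ`, so that
`g` is the weak gradient of `f` on `Σ`, and is determined by `f` almost everywhere. -/
def MemSobolev (w : EuclideanSpace ℝ (Fin n) → ℝ) (f : EuclideanSpace ℝ (Fin n) → ℝ)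
    (g : EuclideanSpace ℝ (Fin n) → EuclideanSpace ℝ (Fin n)) : Prop :=
  MemLp f 2 (mu w) ∧ MemLp g 2 (mu w) ∧
    ∃ u : ℕ → EuclideanSpace ℝ (Fin n) → ℝ, (∀ k, IsTestFunction w (u k)) ∧
      Tendsto (fun k => eLpNorm (fun x => u k x - f x) 2 (mu w) +
        eLpNorm (fun x => gradient (u k) x - g x) 2 (mu w)) atTop (𝓝 0)

/-- `f ∈ W^{1,2}_A(Σ, μ_w)` with gradient `g`, and both `∫_Σ f² dν` and `∫_Σ |∇f|² dν` are
finite. -/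
def Admissible (w : EuclideanSpace ℝ (Fin n) → ℝ) (f : EuclideanSpace ℝ (Fin n) → ℝ)
    (g : EuclideanSpace ℝ (Fin n) → EuclideanSpace ℝ (Fin n)) : Prop :=
  MemSobolev w f g ∧ MemLp f 2 (nu w) ∧ MemLp g 2 (nu w)

/-- `∫ (φ log φ)⁺ dν`. -/
def entPos (ν : Measure (EuclideanSpace ℝ (Fin n))) (φ : EuclideanSpace ℝ (Fin n) → ℝ) : ℝ≥0∞ :=
  ∫⁻ x, ENNReal.ofReal (φ x * Real.log (φ x)) ∂ν

/-- `∫ (φ log φ)⁻ dν`. -/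
def entNeg (ν : Measure (EuclideanSpace ℝ (Fin n))) (φ : EuclideanSpace ℝ (Fin n) → ℝ) : ℝ≥0∞ :=
  ∫⁻ x, ENNReal.ofReal (-(φ x * Real.log (φ x))) ∂ν

/-- `Ent_ν(φ) = ∫ φ log φ dν - (∫ φ dν) log (∫ φ dν)`, for `φ ≥ 0` integrable. As `ν` is an
infinite measure, `∫ φ log φ dν` may be `-∞`; it is taken with values in `[-∞, ∞]`, as the
difference of the integrals of the positive and the negative part. -/
def ent (ν : Measure (EuclideanSpace ℝ (Fin n))) (φ : EuclideanSpace ℝ (Fin n) → ℝ) : EReal :=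
  ((entPos ν φ : ℝ≥0∞) : EReal) - ((entNeg ν φ : ℝ≥0∞) : EReal)
    - (((∫ x, φ x ∂ν) * Real.log (∫ x, φ x ∂ν) : ℝ) : EReal)

/-- The right-hand side
`((n + α) / 2) ∫_Σ f² dν · log (C ∫_Σ |∇f|² dν / ∫_Σ f² dν)`, where `g = ∇f`. -/
def lsiRHS (w : EuclideanSpace ℝ (Fin n) → ℝ) (α C : ℝ) (f : EuclideanSpace ℝ (Fin n) → ℝ)
    (g : EuclideanSpace ℝ (Fin n) → EuclideanSpace ℝ (Fin n)) : ℝ :=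
  (n + α) / 2 * (∫ x, f x ^ 2 ∂(nu w)) *
    Real.log (C * ((∫ x, ‖g x‖ ^ 2 ∂(nu w)) / ∫ x, f x ^ 2 ∂(nu w)))

/-- The logarithmic Sobolev inequality for `ν` with constant `C`. -/
def LSI (w : EuclideanSpace ℝ (Fin n) → ℝ) (α C : ℝ) : Prop :=
  ∀ f g, Admissible w f g → ent (nu w) (fun x => f x ^ 2) ≤ ((lsiRHS w α C f g : ℝ) : EReal)

/-- `C_LSIH = 4 C_w^{2/(n+α)} / (e (n+α))`. -/
def sharpConst (w : EuclideanSpace ℝ (Fin n) → ℝ) (α : ℝ) : ℝ :=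
  4 * normConst w ^ (2 / (n + α)) / (Real.exp 1 * (n + α))

/-- The Gaussian `A e^{-|x|²/4}`. -/
def gaussian (A : ℝ) (x : EuclideanSpace ℝ (Fin n)) : ℝ :=
  A * Real.exp (-‖x‖ ^ 2 / 4)

end WeightedLSI

end

noncomputable section

namespace WeightedLSI

/-!
Homogeneity and log-concavity give `w(x)^t w(y)^s ≤ w(tx + sy)` for `t + s = 1`, so the
Prékopa–Leindler inequality holds for `μ_w` with the convexity gain of the standard Gaussian. As
observed by Bobkov and Ledoux, its infinitesimal form is the Gaussian logarithmic Sobolev inequality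
`Ent_{μ_w}(F²) ≤ 2 ∫ |∇F|² dμ_w`. Inserting `F = f e^{|x|²/4}` and integrating the cross term by
parts with Euler's identity `∫ ∇φ · x dν = -(n + α) ∫ φ dν` turns this into an inequality for `ν`
with the additive defect `log C_w - (n + α)`. Dilating `f` adds a free parameter, and the optimal
dilation produces the logarithm of `∫ |∇f|² dν / ∫ f² dν`.

When `∫ f² log f² dν = -∞` there is nothing to prove, but the positive part has to be bounded first:
this is done by applying the inequality to a truncation of `f` away from its small values. Both
sides pass to the limit along `cutoff R * f`. For the Gaussians, the radial gradient is tangent to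
the cone at its boundary, and all the inequalities above are equalities.
-/

section PrekopaLeindler

open Set Pointwise

lemma brunnMinkowski_real_of_isCompact {t s : ℝ} (ht : 0 < t) (hs : 0 < s) {K L C : Set ℝ}
    (hK : IsCompact K) (hL : IsCompact L) (hKn : K.Nonempty) (hLn : L.Nonempty)
    (hC : ∀ x ∈ K, ∀ y ∈ L, t * x + s * y ∈ C) :
    ENNReal.ofReal t * volume K + ENNReal.ofReal s * volume L ≤ volume C := by
  -- `C` contains the translates `tK + s (min L)` and `t (max K) + sL`, which share one point.
  set k := sSup K
  set l := sInf L
  have hk : k ∈ K := hK.sSup_mem hKn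
  have hl : l ∈ L := hL.sInf_mem hLn
  set P : Set ℝ := (s * l) +ᵥ (t • K)
  set Q : Set ℝ := (t * k) +ᵥ (s • L)
  have hP : volume P = ENNReal.ofReal t * volume K := by
    simp [P, measure_vadd, Measure.addHaar_smul, abs_of_pos ht]
  have hQ : volume Q = ENNReal.ofReal s * volume L := by
    simp [Q, measure_vadd, Measure.addHaar_smul, abs_of_pos hs]
  have hQc : IsCompact Q := (hL.smul s).vadd (t * k)
  have hsub : P ∪ Q ⊆ C := by
    rintro _ (⟨_, ⟨x, hx, rfl⟩, rfl⟩ | ⟨_, ⟨x, hx, rfl⟩, rfl⟩)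
    · simpa [add_comm] using hC x hx l hl
    · simpa [add_comm] using hC k hk x hx
  have hdisj : AEDisjoint volume P Q := by
    refine measure_mono_null (t := {s * l + t * k}) ?_ (by simp)
    rintro _ ⟨⟨_, ⟨x, hx, rfl⟩, rfl⟩, ⟨_, ⟨y, hy, rfl⟩, h⟩⟩
    have hxk : x ≤ k := le_csSup hK.bddAbove hx
    have hly : l ≤ y := csInf_le hL.bddBelow hy
    simp only [vadd_eq_add, smul_eq_mul, mem_singleton_iff] at h ⊢
    nlinarith
  calc _ = volume (P ∪ Q) := by
        rw [measure_union₀ hQc.measurableSet.nullMeasurableSet hdisj, hP, hQ]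
    _ ≤ volume C := measure_mono hsub

lemma measure_le_iSup_isCompact_nonempty {X : Type*} [TopologicalSpace X] [MeasurableSpace X]
    {μ : Measure X} [μ.InnerRegular] {A : Set X} (hA : MeasurableSet A) (hne : A.Nonempty) :
    μ A ≤ ⨆ K : {K : Set X // K ⊆ A ∧ IsCompact K ∧ K.Nonempty}, μ K := by
  obtain ⟨a, ha⟩ := hne
  rw [hA.measure_eq_iSup_isCompact]
  refine iSup₂_le fun K hK => iSup_le fun hKc => (measure_mono subset_union_left).trans
    (le_iSup (fun K : {K : Set X // K ⊆ A ∧ IsCompact K ∧ K.Nonempty} => μ K)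
      ⟨K ∪ {a}, union_subset hK (singleton_subset_iff.2 ha), hKc.union isCompact_singleton,
        ⟨a, mem_union_right _ rfl⟩⟩)

lemma brunnMinkowski_real {t s : ℝ} (ht : 0 < t) (hs : 0 < s) {A B C : Set ℝ}
    (hA : MeasurableSet A) (hB : MeasurableSet B) (hAn : A.Nonempty) (hBn : B.Nonempty)
    (hC : ∀ x ∈ A, ∀ y ∈ B, t * x + s * y ∈ C) :
    ENNReal.ofReal t * volume A + ENNReal.ofReal s * volume B ≤ volume C := by
  have : Nonempty {K : Set ℝ // K ⊆ A ∧ IsCompact K ∧ K.Nonempty} :=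
    let ⟨a, ha⟩ := hAn
    ⟨{a}, singleton_subset_iff.2 ha, isCompact_singleton, singleton_nonempty a⟩
  have : Nonempty {K : Set ℝ // K ⊆ B ∧ IsCompact K ∧ K.Nonempty} :=
    let ⟨b, hb⟩ := hBn
    ⟨{b}, singleton_subset_iff.2 hb, isCompact_singleton, singleton_nonempty b⟩
  refine (add_le_add (mul_le_mul_right (measure_le_iSup_isCompact_nonempty hA hAn) _)
    (mul_le_mul_right (measure_le_iSup_isCompact_nonempty hB hBn) _)).trans ?_
  rw [ENNReal.mul_iSup, ENNReal.mul_iSup]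
  exact ENNReal.iSup_add_iSup_le fun ⟨K, hKA, hK, hKn⟩ ⟨L, hLB, hL, hLn⟩ =>
    brunnMinkowski_real_of_isCompact ht hs hK hL hKn hLn fun x hx y hy => hC x (hKA hx) y (hLB hy)

section LayerCake

variable {X : Type*} [MeasurableSpace X] {f : X → ℝ≥0∞}

lemma measurable_measure_ofReal_lt (μ : Measure X) (f : X → ℝ≥0∞) :
    Measurable fun r : ℝ => μ {x | ENNReal.ofReal r < f x} :=
  Antitone.measurable fun _ _ hr => measure_mono fun _ hx =>
    (ENNReal.ofReal_le_ofReal hr).trans_lt hx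

lemma volume_Ioi_inter_ofReal_lt (c : ℝ≥0∞) :
    volume (Ioi 0 ∩ {r : ℝ | ENNReal.ofReal r < c}) = c := by
  rcases eq_or_ne c ⊤ with rfl | hc
  · simp
  · have : Ioi 0 ∩ {r : ℝ | ENNReal.ofReal r < c} = Ioo 0 c.toReal := by
      ext r
      simp only [mem_inter_iff, mem_Ioi, mem_ofPred_eq, mem_Ioo, and_congr_right_iff]
      exact fun hr => ENNReal.ofReal_lt_iff_lt_toReal hr.le hc
    rw [this, Real.volume_Ioo, sub_zero, ENNReal.ofReal_toReal hc]

lemma lintegral_eq_lintegral_measure_ofReal_lt (μ : Measure X) [SFinite μ] (hf : Measurable f) :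
    ∫⁻ x, f x ∂μ = ∫⁻ r in Ioi (0 : ℝ), μ {x | ENNReal.ofReal r < f x} := by
  have hS : MeasurableSet {p : X × ℝ | ENNReal.ofReal p.2 < f p.1} :=
    measurableSet_lt (by fun_prop) (by fun_prop)
  calc ∫⁻ x, f x ∂μ
      = ∫⁻ x, (volume.restrict (Ioi 0)) {r : ℝ | ENNReal.ofReal r < f x} ∂μ := by
        refine lintegral_congr fun x => ?_
        rw [Measure.restrict_apply' measurableSet_Ioi, inter_comm, volume_Ioi_inter_ofReal_lt]
    _ = (μ.prod (volume.restrict (Ioi 0))) {p : X × ℝ | ENNReal.ofReal p.2 < f p.1} :=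
        (Measure.prod_apply hS).symm
    _ = _ := Measure.prod_apply_symm hS

lemma tendsto_lintegral_min_natCast {μ : Measure X} (hf : Measurable f) :
    Tendsto (fun N : ℕ => ∫⁻ x, min (f x) N ∂μ) atTop (𝓝 (∫⁻ x, f x ∂μ)) := by
  refine lintegral_tendsto_of_tendsto_of_monotone
    (fun N => (hf.min measurable_const).aemeasurable)
    (ae_of_all _ fun x N M hNM => min_le_min_left _ (Nat.cast_le.2 hNM)) (ae_of_all _ fun x => ?_)
  simpa using (tendsto_const_nhds (x := f x)).min ENNReal.tendsto_nat_nhds_top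

end LayerCake

lemma rpow_mul_rpow_le_add {t s : ℝ} (ht : 0 < t) (hs : 0 < s) (hts : t + s = 1) (a b : ℝ≥0∞) :
    a ^ t * b ^ s ≤ ENNReal.ofReal t * a + ENNReal.ofReal s * b := by
  by_cases ha : a = ⊤
  · simp [ha, ENNReal.mul_top, ht]
  by_cases hb : b = ⊤
  · simp [hb, ENNReal.mul_top, hs]
  lift a to NNReal using ha
  lift b to NNReal using hb
  have := NNReal.geom_mean_le_arith_mean2_weighted t.toNNReal s.toNNReal a b
    (by rw [← Real.toNNReal_add ht.le hs.le, hts, Real.toNNReal_one])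
  rw [Real.coe_toNNReal _ ht.le, Real.coe_toNNReal _ hs.le] at this
  rw [← ENNReal.coe_rpow_of_nonneg _ ht.le, ← ENNReal.coe_rpow_of_nonneg _ hs.le]
  simp only [ENNReal.ofReal]
  exact_mod_cast this

/-- A measure `μ` satisfies the **Prékopa–Leindler inequality** with weights `t` and `s`. -/
def PrekopaLeindler {E : Type*} [AddCommGroup E] [Module ℝ E] [MeasurableSpace E]
    (μ : Measure E) (t s : ℝ) : Prop :=
  ∀ ⦃u v h : E → ℝ≥0∞⦄, Measurable u → Measurable v → Measurable h →
    (∀ x y, u x ^ t * v y ^ s ≤ h (t • x + s • y)) →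
      (∫⁻ x, u x ∂μ) ^ t * (∫⁻ x, v x ∂μ) ^ s ≤ ∫⁻ x, h x ∂μ

section Line

variable {t s : ℝ} (ht : 0 < t) (hs : 0 < s) (hts : t + s = 1) {u v h : ℝ → ℝ≥0∞}
  (hu : Measurable u) (hv : Measurable v) (hh : Measurable h)
  (H : ∀ x y, u x ^ t * v y ^ s ≤ h (t * x + s * y))

include ht hs hts hu hv hh H

lemma add_lintegral_le_of_iSup_eq_one (hu1 : ⨆ x, u x = 1) (hv1 : ⨆ x, v x = 1) :
    ENNReal.ofReal t * (∫⁻ x, u x) + ENNReal.ofReal s * (∫⁻ x, v x) ≤ ∫⁻ x, h x := by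
  rw [lintegral_eq_lintegral_measure_ofReal_lt _ hu, lintegral_eq_lintegral_measure_ofReal_lt _ hv,
    lintegral_eq_lintegral_measure_ofReal_lt _ hh,
    ← lintegral_const_mul _ (measurable_measure_ofReal_lt _ u),
    ← lintegral_const_mul _ (measurable_measure_ofReal_lt _ v),
    ← lintegral_add_left ((measurable_measure_ofReal_lt _ u).const_mul _)]
  refine setLIntegral_mono' measurableSet_Ioi fun r (hr : 0 < r) => ?_
  rcases lt_or_ge r 1 with hr1 | hr1
  · have hr1' : ENNReal.ofReal r < 1 := ENNReal.ofReal_lt_one.2 hr1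
    have hr0 : ENNReal.ofReal r ≠ 0 := (ENNReal.ofReal_pos.2 hr).ne'
    have hne : ∀ f : ℝ → ℝ≥0∞, ⨆ x, f x = 1 → {x | ENNReal.ofReal r < f x}.Nonempty :=
      fun f hf => let ⟨x, hx⟩ := lt_iSup_iff.1 (hf ▸ hr1'); ⟨x, hx⟩
    refine brunnMinkowski_real ht hs (measurableSet_lt measurable_const hu)
      (measurableSet_lt measurable_const hv) (hne u hu1) (hne v hv1)
      fun x hx y hy => lt_of_lt_of_le ?_ (H x y)
    calc ENNReal.ofReal r = ENNReal.ofReal r ^ t * ENNReal.ofReal r ^ s := by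
          rw [← ENNReal.rpow_add _ _ hr0 ENNReal.ofReal_ne_top, hts, ENNReal.rpow_one]
      _ < u x ^ t * v y ^ s :=
          ENNReal.mul_lt_mul (ENNReal.rpow_lt_rpow hx ht) (ENNReal.rpow_lt_rpow hy hs)
  · have hempty : ∀ f : ℝ → ℝ≥0∞, ⨆ x, f x = 1 → {x | ENNReal.ofReal r < f x} = ∅ :=
      fun f hf => eq_empty_of_forall_notMem fun x hx => absurd (hx.trans_le (le_iSup f x))
        (not_lt.2 (hf ▸ ENNReal.one_le_ofReal.2 hr1))
    simp [hempty u hu1, hempty v hv1]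

lemma rpow_lintegral_mul_le_of_iSup_ne_top (hub : ⨆ x, u x ≠ ⊤) (hvb : ⨆ x, v x ≠ ⊤) :
    (∫⁻ x, u x) ^ t * (∫⁻ x, v x) ^ s ≤ ∫⁻ x, h x := by
  set a := ⨆ x, u x with ha
  set b := ⨆ x, v x with hb
  rcases eq_or_ne a 0 with ha0 | ha0
  · simp [ENNReal.iSup_eq_zero.1 ha0, ht]
  rcases eq_or_ne b 0 with hb0 | hb0
  · simp [ENNReal.iSup_eq_zero.1 hb0, hs]
  set c := a⁻¹ ^ t * b⁻¹ ^ s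
  have hc0 : c ≠ 0 := by simp [c, ENNReal.rpow_eq_zero_iff, hub, hvb, ha0, hb0]
  have hc : c ≠ ⊤ := ENNReal.mul_ne_top (ENNReal.rpow_ne_top_of_nonneg ht.le (by simpa))
    (ENNReal.rpow_ne_top_of_nonneg hs.le (by simpa))
  have hsplit : ∀ p q : ℝ≥0∞, (a⁻¹ * p) ^ t * (b⁻¹ * q) ^ s = c * (p ^ t * q ^ s) := fun p q => by
    rw [ENNReal.mul_rpow_of_nonneg _ _ ht.le, ENNReal.mul_rpow_of_nonneg _ _ hs.le,
      mul_mul_mul_comm]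
  have key := add_lintegral_le_of_iSup_eq_one ht hs hts (hu.const_mul a⁻¹) (hv.const_mul b⁻¹)
    (hh.const_mul c) (fun x y => (hsplit _ _).trans_le (mul_le_mul_right (H x y) c))
    (by rw [← ENNReal.mul_iSup, ← ha, ENNReal.inv_mul_cancel ha0 hub])
    (by rw [← ENNReal.mul_iSup, ← hb, ENNReal.inv_mul_cancel hb0 hvb])
  have := (rpow_mul_rpow_le_add ht hs hts _ _).trans key
  rw [lintegral_const_mul _ hu, lintegral_const_mul _ hv, lintegral_const_mul _ hh, hsplit] at this
  exact (ENNReal.mul_le_mul_iff_right hc0 hc).1 this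

omit hu hv hh H in
lemma prekopaLeindler_real : PrekopaLeindler (volume : Measure ℝ) t s := by
  intro u v h hu hv hh H
  have truncated (N : ℕ) : (∫⁻ x, min (u x) N) ^ t * (∫⁻ x, min (v x) N) ^ s ≤ ∫⁻ x, h x := by
    refine rpow_lintegral_mul_le_of_iSup_ne_top ht hs hts (hu.min measurable_const)
      (hv.min measurable_const) hh (fun x y => le_trans ?_ (H x y))
      (ne_top_of_le_ne_top (ENNReal.natCast_ne_top N) (iSup_le fun x => min_le_right _ _))
      (ne_top_of_le_ne_top (ENNReal.natCast_ne_top N) (iSup_le fun x => min_le_right _ _))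
    gcongr <;> exact min_le_left _ _
  rcases eq_or_ne (∫⁻ x, u x) 0 with hu0 | hu0
  · simp [hu0, ht]
  rcases eq_or_ne (∫⁻ x, v x) 0 with hv0 | hv0
  · simp [hv0, hs]
  refine le_of_tendsto' (ENNReal.Tendsto.mul
    ((ENNReal.continuous_rpow_const.tendsto _).comp (tendsto_lintegral_min_natCast hu)) (Or.inl ?_)
    ((ENNReal.continuous_rpow_const.tendsto _).comp (tendsto_lintegral_min_natCast hv))
    (Or.inl ?_)) truncated
  · simp [ENNReal.rpow_eq_zero_iff, hu0, ht.le]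
  · simp [ENNReal.rpow_eq_zero_iff, hv0, hs.le]

end Line

section Transfer

variable {t s : ℝ} {E F : Type*} [AddCommGroup E] [Module ℝ E] [MeasurableSpace E]
  [AddCommGroup F] [Module ℝ F] [MeasurableSpace F] {μ : Measure E} {ν : Measure F}

lemma PrekopaLeindler.prod [SFinite μ] [SFinite ν] (hμ : PrekopaLeindler μ t s)
    (hν : PrekopaLeindler ν t s) : PrekopaLeindler (μ.prod ν) t s := by
  intro u v h hu hv hh H
  rw [lintegral_prod _ hu.aemeasurable, lintegral_prod _ hv.aemeasurable,
    lintegral_prod _ hh.aemeasurable]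
  exact hμ hu.lintegral_prod_right' hv.lintegral_prod_right' hh.lintegral_prod_right' fun x₁ x₂ =>
    hν (hu.comp measurable_prodMk_left) (hv.comp measurable_prodMk_left)
      (hh.comp measurable_prodMk_left) fun y₁ y₂ => H (x₁, y₁) (x₂, y₂)

lemma PrekopaLeindler.of_measurePreserving (hμ : PrekopaLeindler μ t s) {f : E → F}
    (hf : MeasurePreserving f μ ν) (hlin : IsLinearMap ℝ f) : PrekopaLeindler ν t s := by
  intro u v h hu hv hh H
  rw [← hf.lintegral_comp hu, ← hf.lintegral_comp hv, ← hf.lintegral_comp hh]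
  exact hμ (hu.comp hf.measurable) (hv.comp hf.measurable) (hh.comp hf.measurable) fun x y => by
    simpa only [Function.comp_apply, hlin.map_add, hlin.map_smul] using H (f x) (f y)

end Transfer

variable {t s : ℝ} (ht : 0 < t) (hs : 0 < s) (hts : t + s = 1) (n : ℕ)

include ht hs hts

lemma prekopaLeindler_pi : PrekopaLeindler (volume : Measure (Fin n → ℝ)) t s := by
  induction n with
  | zero =>
    intro u v h _ _ _ H
    rw [volume_pi, Measure.pi_of_empty _ 0]
    simpa using H 0 0
  | succ n ih =>
    refine ((prekopaLeindler_real ht hs hts).prod ih).of_measurePreserving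
      (volume_preserving_piFinSuccAbove (fun _ : Fin (n + 1) => ℝ) 0).symm ⟨?_, ?_⟩
    · intro x y
      ext i
      refine Fin.cases ?_ (fun i => ?_) i <;> simp [MeasurableEquiv.piFinSuccAbove]
    · intro c x
      ext i
      refine Fin.cases ?_ (fun i => ?_) i <;> simp [MeasurableEquiv.piFinSuccAbove]

theorem prekopaLeindler_euclideanSpace :
    PrekopaLeindler (volume : Measure (EuclideanSpace ℝ (Fin n))) t s :=
  (prekopaLeindler_pi ht hs hts n).of_measurePreserving (PiLp.volume_preserving_toLp (Fin n))
    (WithLp.linearEquiv 2 ℝ (Fin n → ℝ)).symm.toLinearMap.isLinear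

end PrekopaLeindler

section LogSobolev

/-- The entropy `∫ φ log φ dμ - (∫ φ dμ) log (∫ φ dμ)` as a real number, for integrable
`φ log φ`; `ent` also covers the case where the integral is `-∞`. -/
def entropy {X : Type*} [MeasurableSpace X] (μ : Measure X) (φ : X → ℝ) : ℝ :=
  ∫ x, φ x * Real.log (φ x) ∂μ - (∫ x, φ x ∂μ) * Real.log (∫ x, φ x ∂μ)

section Entropy

variable {X : Type*} [MeasurableSpace X] {μ : Measure X}

lemma hasDerivAt_integral_exp_add_mul [IsFiniteMeasure μ] {g h : X → ℝ}
    (hg : AEStronglyMeasurable g μ) (hh : AEStronglyMeasurable h μ) {B K : ℝ}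
    (hgB : ∀ x, |g x| ≤ B) (hhK : ∀ x, |h x| ≤ K) :
    HasDerivAt (fun s : ℝ => ∫ x, Real.exp (g x + s * h x) ∂μ)
      (∫ x, h x * Real.exp (g x) ∂μ) 0 := by
  have hmeas (s : ℝ) : AEStronglyMeasurable (fun x => Real.exp (g x + s * h x)) μ :=
    Real.continuous_exp.comp_aestronglyMeasurable (hg.add (hh.const_mul s))
  have hbound (x : X) (s : ℝ) (hs : s ∈ Metric.ball (0 : ℝ) 1) :
      ‖Real.exp (g x + s * h x) * h x‖ ≤ Real.exp (B + K) * K := by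
    rw [norm_mul, Real.norm_of_nonneg (Real.exp_nonneg _)]
    have hs1 : |s| ≤ 1 := by simpa using (mem_ball_zero_iff.1 hs).le
    have hsh : s * h x ≤ K := calc
      s * h x ≤ |s| * |h x| := (le_abs_self _).trans (abs_mul _ _).le
      _ ≤ |h x| := mul_le_of_le_one_left (abs_nonneg _) hs1
      _ ≤ K := hhK x
    gcongr
    exacts [(le_abs_self _).trans (hgB x), hhK x]
  obtain ⟨-, hderiv⟩ := hasDerivAt_integral_of_dominated_loc_of_deriv_le
    (F := fun s x => Real.exp (g x + s * h x))
    (F' := fun s x => Real.exp (g x + s * h x) * h x) (x₀ := (0 : ℝ))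
    (Metric.ball_mem_nhds 0 one_pos) (Eventually.of_forall hmeas)
    (Integrable.of_bound (hmeas 0) (Real.exp B) (ae_of_all _ fun x => by
      simpa using (le_abs_self _).trans (hgB x)))
    ((hmeas 0).mul hh) (ae_of_all _ hbound) (integrable_const _)
    (ae_of_all _ fun x s _ => by
      simpa using (((hasDerivAt_id s).mul_const (h x)).const_add (g x)).exp)
  simpa [mul_comm] using hderiv

lemma tendsto_entropy_add_const [IsProbabilityMeasure μ] {φ : X → ℝ}
    (hφ : AEStronglyMeasurable φ μ) (hφ0 : ∀ x, 0 ≤ φ x) {N : ℝ} (hφN : ∀ x, φ x ≤ N) :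
    Tendsto (fun ε => entropy μ fun x => φ x + ε) (𝓝[>] 0) (𝓝 (entropy μ φ)) := by
  have hcont : Continuous fun r : ℝ => r * Real.log r := Real.continuous_mul_log
  have hint : Integrable φ μ := .of_bound hφ N (ae_of_all _ fun x => by
    rw [Real.norm_of_nonneg (hφ0 x)]; exact hφN x)
  have hmass (ε : ℝ) : ∫ x, φ x + ε ∂μ = ∫ x, φ x ∂μ + ε := by
    rw [integral_add hint (integrable_const _)]; simp
  obtain ⟨K, hK⟩ := (isCompact_Icc (a := (0 : ℝ)) (b := N + 1)).exists_bound_of_continuousOn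
    hcont.continuousOn
  simp only [entropy, hmass]
  refine Tendsto.sub ?_ ?_
  · refine tendsto_integral_filter_of_dominated_convergence (fun _ => K) ?_ ?_
      (integrable_const _) ?_
    · exact Eventually.of_forall fun ε =>
        hcont.comp_aestronglyMeasurable (hφ.add aestronglyMeasurable_const)
    · filter_upwards [Ioo_mem_nhdsGT (zero_lt_one' ℝ)] with ε hε
      exact ae_of_all _ fun x => hK _ ⟨add_nonneg (hφ0 x) hε.1.le, add_le_add (hφN x) hε.2.le⟩
    · refine ae_of_all _ fun x => ?_
      have : Continuous fun ε : ℝ => (φ x + ε) * Real.log (φ x + ε) := hcont.comp (by fun_prop)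
      simpa using (this.tendsto 0).mono_left nhdsWithin_le_nhds
  · have : Continuous fun ε : ℝ => (∫ x, φ x ∂μ + ε) * Real.log (∫ x, φ x ∂μ + ε) :=
      hcont.comp (by fun_prop)
    simpa using (this.tendsto 0).mono_left nhdsWithin_le_nhds

end Entropy

lemma nonneg_of_hasDerivAt_of_eventually_nonneg {ψ : ℝ → ℝ} {ψ' : ℝ} (hψ : HasDerivAt ψ ψ' 0)
    (hψ0 : ψ 0 = 0) (hpos : ∀ᶠ d in 𝓝[>] 0, 0 ≤ ψ d) : 0 ≤ ψ' := by
  have hslope := (hasDerivAt_iff_tendsto_slope.1 hψ).mono_left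
    (nhdsWithin_mono 0 (show Set.Ioi (0 : ℝ) ⊆ {0}ᶜ from fun _ hd => ne_of_gt hd))
  refine ge_of_tendsto hslope ?_
  filter_upwards [hpos, self_mem_nhdsWithin] with d hd (hd0 : 0 < d)
  rw [slope_def_field, hψ0, sub_zero, sub_zero]
  exact div_nonneg hd hd0.le

section Pointwise

variable {E : Type*} [NormedAddCommGroup E] [NormedSpace ℝ E] {g : E → ℝ} {M : ℝ}

lemma le_taylor_of_fderiv_lipschitz (hg : Differentiable ℝ g)
    (hM : ∀ x y, ‖fderiv ℝ g x - fderiv ℝ g y‖ ≤ M * ‖x - y‖) (x z : E) :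
    g x ≤ g z + fderiv ℝ g z (x - z) + M * ‖x - z‖ ^ 2 := by
  have hseg : ∀ y ∈ segment ℝ z x, ‖fderiv ℝ g y - fderiv ℝ g z‖ ≤ M * ‖x - z‖ := by
    intro y hy
    have hMxz : 0 ≤ M * ‖x - z‖ := (norm_nonneg _).trans (hM x z)
    obtain ⟨θ, ⟨hθ0, hθ1⟩, rfl⟩ := segment_eq_image' ℝ z x ▸ hy
    calc _ ≤ M * ‖z + θ • (x - z) - z‖ := hM _ _
      _ = θ * (M * ‖x - z‖) := by
        rw [add_sub_cancel_left, norm_smul, Real.norm_of_nonneg hθ0, mul_left_comm]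
      _ ≤ M * ‖x - z‖ := mul_le_of_le_one_left hMxz hθ1
  have hmean := (convex_segment z x).norm_image_sub_le_of_norm_hasFDerivWithin_le'
    (fun y _ => (hg y).hasFDerivAt.hasFDerivWithinAt) hseg (left_mem_segment ℝ z x)
    (right_mem_segment ℝ z x)
  have := le_of_abs_le (Real.norm_eq_abs _ ▸ hmean)
  linarith

lemma sub_norm_sq_le_add_norm_fderiv_sq (hg : Differentiable ℝ g)
    (hM : ∀ x y, ‖fderiv ℝ g x - fderiv ℝ g y‖ ≤ M * ‖x - y‖) {d : ℝ} (hd : 0 < d)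
    (hMd : 2 * M * d < 1) (x z : E) :
    g x - ‖x - z‖ ^ 2 / (2 * d) ≤ g z + d / (2 * (1 - 2 * M * d)) * ‖fderiv ℝ g z‖ ^ 2 := by
  have hq : 0 < 1 - 2 * M * d := by linarith
  have htaylor := le_taylor_of_fderiv_lipschitz hg hM x z
  have hop : fderiv ℝ g z (x - z) ≤ ‖fderiv ℝ g z‖ * ‖x - z‖ :=
    (le_abs_self _).trans ((fderiv ℝ g z).le_opNorm _)
  set a := ‖fderiv ℝ g z‖
  set k := ‖x - z‖
  have complete_square (q : ℝ) (hq : 0 < q) (hMq : M = (1 - q) / (2 * d)) :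
      d / (2 * q) * a ^ 2 - (a * k + M * k ^ 2 - k ^ 2 / (2 * d))
        = (d * a - q * k) ^ 2 / (2 * d * q) := by
    subst hMq; field_simp; ring
  have hsq := complete_square _ hq (by field_simp; ring)
  have : 0 ≤ (d * a - (1 - 2 * M * d) * k) ^ 2 / (2 * d * (1 - 2 * M * d)) := by positivity
  linarith

lemma norm_fderiv_log_sq_mul_le {F : E → ℝ} {x : E} (hF : DifferentiableAt ℝ F x) {ε : ℝ}
    (hε : 0 < ε) :
    ‖fderiv ℝ (fun y => Real.log (F y ^ 2 + ε)) x‖ ^ 2 * (F x ^ 2 + ε)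
      ≤ 4 * ‖fderiv ℝ F x‖ ^ 2 := by
  have hpos : 0 < F x ^ 2 + ε := by positivity
  have hderiv : HasFDerivAt (fun y => Real.log (F y ^ 2 + ε))
      ((F x ^ 2 + ε)⁻¹ • ((2 * F x) • fderiv ℝ F x)) x := by
    simpa using ((hF.hasFDerivAt.pow 2).add_const ε).log hpos.ne'
  rw [hderiv.fderiv, norm_smul, norm_smul, Real.norm_of_nonneg (inv_nonneg.2 hpos.le),
    Real.norm_eq_abs, mul_pow, mul_pow, sq_abs]
  calc _ = 4 * ‖fderiv ℝ F x‖ ^ 2 * (F x ^ 2 / (F x ^ 2 + ε)) := by field_simp; ring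
    _ ≤ 4 * ‖fderiv ℝ F x‖ ^ 2 :=
      mul_le_of_le_one_right (by positivity) ((div_le_one hpos).2 (by linarith))

end Pointwise

variable {E : Type*} [NormedAddCommGroup E] [NormedSpace ℝ E] [MeasurableSpace E]

/-- The Prékopa–Leindler inequality of a probability measure `μ` which is at least as log-concave
as the standard Gaussian, with `1` as one of the two functions, in exponential form: the
convexity gain `t s ‖x - y‖² / 2` appears in the hypothesis. It is the only property of `μ` on
which the logarithmic Sobolev inequality below depends. -/
def GaussianPrekopaLeindler (μ : Measure E) : Prop :=
  ∀ ⦃t s : ℝ⦄, 0 < t → 0 < s → t + s = 1 → ∀ ⦃u h : E → ℝ⦄, Measurable u → Measurable h →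
    (∀ x y, t * u x - t * s / 2 * ‖x - y‖ ^ 2 ≤ h (t • x + s • y)) →
      (∫⁻ x, ENNReal.ofReal (Real.exp (u x)) ∂μ) ^ t ≤ ∫⁻ x, ENNReal.ofReal (Real.exp (h x)) ∂μ

lemma gaussianPrekopaLeindler_withDensity {μ : Measure E}
    (hμ : ∀ ⦃t s : ℝ⦄, 0 < t → 0 < s → t + s = 1 → PrekopaLeindler μ t s) {ρ : E → ℝ≥0∞}
    (hρ : Measurable ρ) (hmass : ∫⁻ x, ρ x ∂μ = 1)
    (hconc : ∀ ⦃t s : ℝ⦄, 0 < t → 0 < s → t + s = 1 → ∀ x y,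
      ρ x ^ t * ρ y ^ s * ENNReal.ofReal (Real.exp (t * s / 2 * ‖x - y‖ ^ 2))
        ≤ ρ (t • x + s • y)) :
    GaussianPrekopaLeindler (μ.withDensity ρ) := by
  intro t s ht hs hts u h hu hh H
  have hmeas {φ : E → ℝ} (hφ : Measurable φ) :
      Measurable fun x => ENNReal.ofReal (Real.exp (φ x)) := by fun_prop
  have key := hμ ht hs hts (hρ.mul (hmeas hu)) hρ (hρ.mul (hmeas hh)) fun x y => ?_
  · rw [lintegral_withDensity_eq_lintegral_mul _ hρ (hmeas hu),
      lintegral_withDensity_eq_lintegral_mul _ hρ (hmeas hh)]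
    rwa [hmass, ENNReal.one_rpow, mul_one] at key
  have hexp : ENNReal.ofReal (Real.exp (u x)) ^ t
      ≤ ENNReal.ofReal (Real.exp (t * s / 2 * ‖x - y‖ ^ 2))
        * ENNReal.ofReal (Real.exp (h (t • x + s • y))) := by
    rw [ENNReal.ofReal_rpow_of_nonneg (Real.exp_nonneg _) ht.le, ← Real.exp_mul,
      ← ENNReal.ofReal_mul (Real.exp_nonneg _), ← Real.exp_add]
    refine ENNReal.ofReal_le_ofReal (Real.exp_le_exp.2 ?_)
    linarith [H x y]
  calc (ρ x * ENNReal.ofReal (Real.exp (u x))) ^ t * ρ y ^ s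
      = ρ x ^ t * ρ y ^ s * ENNReal.ofReal (Real.exp (u x)) ^ t := by
        rw [ENNReal.mul_rpow_of_nonneg _ _ ht.le, mul_right_comm]
    _ ≤ ρ x ^ t * ρ y ^ s * ENNReal.ofReal (Real.exp (t * s / 2 * ‖x - y‖ ^ 2))
          * ENNReal.ofReal (Real.exp (h (t • x + s • y))) := by
        rw [mul_assoc (ρ x ^ t * ρ y ^ s)]; gcongr
    _ ≤ ρ (t • x + s • y) * ENNReal.ofReal (Real.exp (h (t • x + s • y))) := by
        gcongr; exact hconc ht hs hts x y

variable [BorelSpace E] {μ : Measure E} [IsProbabilityMeasure μ]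

lemma log_integral_exp_le (hμ : GaussianPrekopaLeindler μ) {g : E → ℝ} (hg : ContDiff ℝ 1 g)
    {B M K : ℝ} (hB : ∀ x, |g x| ≤ B) (hK : ∀ x, ‖fderiv ℝ g x‖ ≤ K)
    (hM : ∀ x y, ‖fderiv ℝ g x - fderiv ℝ g y‖ ≤ M * ‖x - y‖) {d : ℝ} (hd : 0 < d)
    (hMd : 2 * M * d < 1) :
    Real.log (∫ x, Real.exp ((1 + d) * g x) ∂μ) ≤ (1 + d) * Real.log
      (∫ x, Real.exp (g x + d / (2 * (1 - 2 * M * d)) * ‖fderiv ℝ g x‖ ^ 2) ∂μ) := by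
  have hgc := hg.continuous
  have : Continuous fun x => ‖fderiv ℝ g x‖ := (hg.continuous_fderiv (by simp)).norm
  set κ := d / (2 * (1 - 2 * M * d))
  have h1d : 0 < 1 + d := by linarith
  have : 0 ≤ κ := div_nonneg hd.le (by linarith)
  have hpl := hμ (t := 1 / (1 + d)) (s := d / (1 + d)) (by positivity) (by positivity)
    (by field_simp) (u := fun x => (1 + d) * g x) (h := fun x => g x + κ * ‖fderiv ℝ g x‖ ^ 2)
    (by fun_prop) (by fun_prop) fun x y => by
      set z := (1 / (1 + d)) • x + (d / (1 + d)) • y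
      have hxz : x - z = (d / (1 + d)) • (x - y) := by
        have : (1 : ℝ) / (1 + d) = 1 - d / (1 + d) := by field_simp; ring
        simp only [z, this]; module
      have hcost : 1 / (1 + d) * (d / (1 + d)) / 2 * ‖x - y‖ ^ 2 = ‖x - z‖ ^ 2 / (2 * d) := by
        rw [hxz, norm_smul, Real.norm_of_nonneg (by positivity)]; field_simp
      rw [hcost, ← mul_assoc, one_div_mul_cancel h1d.ne', one_mul]
      exact sub_norm_sq_le_add_norm_fderiv_sq (hg.differentiable (by simp)) hM hd hMd x z
  have hleft : Integrable (fun x => Real.exp ((1 + d) * g x)) μ :=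
    .of_bound (by fun_prop) (Real.exp ((1 + d) * B)) (ae_of_all _ fun x => by
      rw [Real.norm_of_nonneg (Real.exp_nonneg _)]
      gcongr; exact (le_abs_self _).trans (hB x))
  have hright : Integrable (fun x => Real.exp (g x + κ * ‖fderiv ℝ g x‖ ^ 2)) μ :=
    .of_bound (by fun_prop) (Real.exp (B + κ * K ^ 2)) (ae_of_all _ fun x => by
      rw [Real.norm_of_nonneg (Real.exp_nonneg _)]
      gcongr; exacts [(le_abs_self _).trans (hB x), hK x])
  rw [← ofReal_integral_eq_lintegral_ofReal hleft (ae_of_all _ fun _ => Real.exp_nonneg _),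
    ← ofReal_integral_eq_lintegral_ofReal hright (ae_of_all _ fun _ => Real.exp_nonneg _),
    ENNReal.ofReal_rpow_of_nonneg (integral_nonneg fun _ => Real.exp_nonneg _) (by positivity),
    ENNReal.ofReal_le_ofReal_iff (integral_nonneg fun _ => Real.exp_nonneg _)] at hpl
  have hpos := integral_exp_pos hleft
  have := Real.log_le_log (by positivity) hpl
  rwa [Real.log_rpow hpos, one_div, inv_mul_le_iff₀ h1d] at this

/-- The inequality is the derivative at `d = 0` of the Prékopa–Leindler estimate
`log_integral_exp_le`, in which equality holds for `d = 0`. -/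
lemma entropy_exp_le (hμ : GaussianPrekopaLeindler μ) {g : E → ℝ} (hg : ContDiff ℝ 1 g)
    {B M K : ℝ} (hB : ∀ x, |g x| ≤ B) (hK : ∀ x, ‖fderiv ℝ g x‖ ≤ K)
    (hM : ∀ x y, ‖fderiv ℝ g x - fderiv ℝ g y‖ ≤ M * ‖x - y‖) :
    entropy μ (fun x => Real.exp (g x))
      ≤ 1 / 2 * ∫ x, ‖fderiv ℝ g x‖ ^ 2 * Real.exp (g x) ∂μ := by
  have hgc := hg.continuous
  have hDc : Continuous fun x => ‖fderiv ℝ g x‖ := (hg.continuous_fderiv (by simp)).norm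
  have hDK (x : E) : |‖fderiv ℝ g x‖ ^ 2| ≤ K ^ 2 := by
    rw [abs_of_nonneg (sq_nonneg _)]; gcongr; exact hK x
  set A := ∫ x, Real.exp (g x) ∂μ
  set T := ∫ x, g x * Real.exp (g x) ∂μ
  set J := ∫ x, ‖fderiv ℝ g x‖ ^ 2 * Real.exp (g x) ∂μ
  have hA : 0 < A := integral_exp_pos (.of_bound (by fun_prop) (Real.exp B)
    (ae_of_all _ fun x => by simpa using (le_abs_self _).trans (hB x)))
  set κ : ℝ → ℝ := fun d => d / (2 * (1 - 2 * M * d))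
  have hκ0 : κ 0 = 0 := by simp [κ]
  have hκ' : HasDerivAt κ (1 / 2) 0 := by
    have hden : HasDerivAt (fun d : ℝ => 2 * (1 - 2 * M * d)) (2 * (0 - 2 * M * 1)) 0 :=
      ((hasDerivAt_const _ _).sub ((hasDerivAt_id' _).const_mul _)).const_mul 2
    exact ((hasDerivAt_id' (0 : ℝ)).div hden (by norm_num)).congr_deriv (by norm_num)
  set P : ℝ → ℝ := fun d => ∫ x, Real.exp (g x + κ d * ‖fderiv ℝ g x‖ ^ 2) ∂μ
  set R : ℝ → ℝ := fun d => ∫ x, Real.exp (g x + d * g x) ∂μ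
  have hP0 : P 0 = A := by simp [P, hκ0, A]
  have hR0 : R 0 = A := by simp [R, A]
  have hP' : HasDerivAt P (J * (1 / 2)) 0 :=
    (hκ0.symm ▸ hasDerivAt_integral_exp_add_mul hgc.aestronglyMeasurable
      (hDc.pow 2).aestronglyMeasurable hB hDK).comp 0 hκ'
  have hR' : HasDerivAt R T 0 := hasDerivAt_integral_exp_add_mul hgc.aestronglyMeasurable
    hgc.aestronglyMeasurable hB hB
  have hψ' := ((((hasDerivAt_id' (0 : ℝ)).const_add 1).mul (hP'.log (hP0 ▸ hA.ne'))).sub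
    (hR'.log (hR0 ▸ hA.ne')))
  have hnonneg := nonneg_of_hasDerivAt_of_eventually_nonneg hψ' (by simp [hP0, hR0]) <| by
    have hsmall : ∀ᶠ d in 𝓝 (0 : ℝ), 2 * M * d < 1 :=
      (by fun_prop : ContinuousAt (fun d => 2 * M * d) 0).eventually_lt_const (by simp)
    filter_upwards [self_mem_nhdsWithin, nhdsWithin_le_nhds hsmall] with d hd hMd
    simpa [P, R, κ, one_add_mul] using log_integral_exp_le hμ hg hB hK hM hd hMd
  simp only [hP0, hR0, add_zero, one_mul] at hnonneg
  have : (Real.log A + J * (1 / 2) / A - T / A) * A = A * Real.log A + J / 2 - T := by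
    field_simp
  simp only [entropy, Real.log_exp, mul_comm (Real.exp _)]
  linarith [mul_nonneg hnonneg hA.le]

lemma entropy_sq_add_le (hμ : GaussianPrekopaLeindler μ) {F : E → ℝ} (hF : ContDiff ℝ 2 F)
    (hFc : HasCompactSupport F) {ε : ℝ} (hε : 0 < ε) :
    entropy μ (fun x => F x ^ 2 + ε) ≤ 2 * ∫ x, ‖fderiv ℝ F x‖ ^ 2 ∂μ := by
  have hpos (x : E) : 0 < F x ^ 2 + ε := by positivity
  set g : E → ℝ := fun x => Real.log (F x ^ 2 + ε)
  have hg : ContDiff ℝ 2 g := ((hF.pow 2).add contDiff_const).log fun x => (hpos x).ne'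
  have hDg : ContDiff ℝ 1 (fderiv ℝ g) := hg.fderiv_right (by norm_num)
  have hgc : HasCompactSupport fun x => g x - Real.log ε :=
    hFc.comp_left (g := fun r : ℝ => Real.log (r ^ 2 + ε) - Real.log ε) (by simp)
  have hDgc : HasCompactSupport (fderiv ℝ g) := by
    have : fderiv ℝ (fun x => g x - Real.log ε) = fderiv ℝ g := by ext1 x; rw [fderiv_sub_const]
    exact this ▸ hgc.fderiv ℝ
  obtain ⟨B, hB⟩ := hgc.exists_bound_of_continuous (hg.continuous.sub continuous_const)
  obtain ⟨K, hK⟩ := hDgc.exists_bound_of_continuous hDg.continuous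
  obtain ⟨M, hM⟩ := hDg.lipschitzWith_of_hasCompactSupport hDgc one_ne_zero
  obtain ⟨N, hN⟩ := (hFc.fderiv ℝ).exists_bound_of_continuous (hF.continuous_fderiv (by simp))
  have hgB (x : E) : |g x| ≤ B + |Real.log ε| := by
    have htri := abs_add_le (g x - Real.log ε) (Real.log ε)
    rw [sub_add_cancel] at htri
    linarith [hB x, Real.norm_eq_abs (g x - Real.log ε)]
  have key := entropy_exp_le hμ (hg.of_le (by norm_num)) hgB hK fun x y => hM.norm_sub_le x y
  have hexp (x : E) : Real.exp (g x) = F x ^ 2 + ε := Real.exp_log (hpos x)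
  simp only [hexp] at key
  have hDF : Continuous fun x => ‖fderiv ℝ F x‖ := (hF.continuous_fderiv (by simp)).norm
  have hint : Integrable (fun x => ‖fderiv ℝ F x‖ ^ 2) μ :=
    .of_bound (hDF.pow 2).aestronglyMeasurable (N ^ 2) (ae_of_all _ fun x => by
      rw [Real.norm_of_nonneg (sq_nonneg _)]; gcongr; exact hN x)
  calc entropy μ (fun x => F x ^ 2 + ε)
      ≤ 1 / 2 * ∫ x, ‖fderiv ℝ g x‖ ^ 2 * (F x ^ 2 + ε) ∂μ := key
    _ ≤ 1 / 2 * ∫ x, 4 * ‖fderiv ℝ F x‖ ^ 2 ∂μ := by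
      refine mul_le_mul_of_nonneg_left (integral_mono_of_nonneg
        (ae_of_all _ fun x => mul_nonneg (sq_nonneg _) (hpos x).le) (hint.const_mul 4)
        (ae_of_all _ fun x => ?_)) (by norm_num)
      exact norm_fderiv_log_sq_mul_le (hF.differentiable (by simp) x) hε
    _ = 2 * ∫ x, ‖fderiv ℝ F x‖ ^ 2 ∂μ := by rw [integral_const_mul]; ring

theorem entropy_sq_le (hμ : GaussianPrekopaLeindler μ) {F : E → ℝ} (hF : ContDiff ℝ 2 F)
    (hFc : HasCompactSupport F) :
    entropy μ (fun x => F x ^ 2) ≤ 2 * ∫ x, ‖fderiv ℝ F x‖ ^ 2 ∂μ := by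
  obtain ⟨N, hN⟩ := hFc.exists_bound_of_continuous hF.continuous
  refine le_of_tendsto (tendsto_entropy_add_const (hF.continuous.pow 2).aestronglyMeasurable
    (fun x => sq_nonneg (F x)) (N := N ^ 2) fun x => ?_) ?_
  · rw [← sq_abs]; exact pow_le_pow_left₀ (abs_nonneg _) (hN x) 2
  · filter_upwards [self_mem_nhdsWithin] with ε hε using entropy_sq_add_le hμ hF hFc hε

end LogSobolev

local notation "𝔼" n => EuclideanSpace ℝ (Fin n)

lemma exists_le_mul_one_add_norm_of_concaveOn {E : Type*} [NormedAddCommGroup E] [NormedSpace ℝ E]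
    [FiniteDimensional ℝ E] {S : Set E} {φ : E → ℝ} (hφ : ConcaveOn ℝ S φ) (hS : IsOpen S)
    (hS₀ : S.Nonempty) : ∃ C, ∀ x ∈ S, φ x ≤ C * (1 + ‖x‖) := by
  obtain ⟨x₀, hx₀⟩ := hS₀
  obtain ⟨K, U, hU, hlip⟩ := hφ.locallyLipschitzOn hS hx₀
  rw [hS.nhdsWithin_eq hx₀] at hU
  have hcone (x : E) (hx : x ∈ S) : φ x - φ x₀ ≤ K * ‖x - x₀‖ := by
    have hseg : ∀ᶠ θ : ℝ in 𝓝[>] 0, x₀ + θ • (x - x₀) ∈ U := nhdsWithin_le_nhds <|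
      (by fun_prop : ContinuousAt (fun θ : ℝ => x₀ + θ • (x - x₀)) 0) (by simpa using hU)
    obtain ⟨θ, hθU, hθ0, hθ1⟩ := (hseg.and (Ioo_mem_nhdsGT (zero_lt_one' ℝ))).exists
    have hconc := hφ.2 hx₀ hx (sub_nonneg.2 hθ1.le) hθ0.le (sub_add_cancel 1 θ)
    have hpoint : (1 - θ) • x₀ + θ • x = x₀ + θ • (x - x₀) := by module
    have hnear : φ (x₀ + θ • (x - x₀)) - φ x₀ ≤ K * (θ * ‖x - x₀‖) := by
      have := (le_abs_self _).trans (hlip.norm_sub_le hθU (mem_of_mem_nhds hU))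
      rwa [add_sub_cancel_left, norm_smul, Real.norm_of_nonneg hθ0.le] at this
    rw [hpoint, smul_eq_mul, smul_eq_mul] at hconc
    refine le_of_mul_le_mul_left ?_ hθ0
    linarith
  refine ⟨|φ x₀| + K * (1 + ‖x₀‖), fun x hx => ?_⟩
  have hK : (K : ℝ) * ‖x - x₀‖ ≤ K * (‖x‖ + ‖x₀‖) := by gcongr; exact norm_sub_le x x₀
  have hprod : 0 ≤ |φ x₀| * ‖x‖ + K * (1 + ‖x₀‖ * ‖x‖) := by positivity
  linarith [hcone x hx, le_abs_self (φ x₀)]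

lemma integrable_exp_neg_mul_sq_norm {E : Type*} [NormedAddCommGroup E] [InnerProductSpace ℝ E]
    [FiniteDimensional ℝ E] [MeasurableSpace E] [BorelSpace E] {c : ℝ} (hc : 0 < c) :
    Integrable fun x : E => Real.exp (-c * ‖x‖ ^ 2) :=
  .of_integral_ne_zero (by rw [GaussianFourier.integral_rexp_neg_mul_sq_norm hc]; positivity)

lemma withDensity_restrict_of_eq_zero {X : Type*} [MeasurableSpace X] {μ : Measure X} {S : Set X}
    (hS : MeasurableSet S) {ρ : X → ℝ≥0∞} (hρ : ∀ x ∉ S, ρ x = 0) :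
    (μ.restrict S).withDensity ρ = μ.withDensity ρ := by
  rw [← withDensity_indicator hS, Set.indicator_eq_self.2 (Function.support_subset_iff'.2 hρ)]

lemma exp_rpow_mul_exp_rpow_mul_exp {E : Type*} [NormedAddCommGroup E] [InnerProductSpace ℝ E]
    {t s : ℝ} (hts : t + s = 1) (x y : E) :
    Real.exp (-‖x‖ ^ 2 / 2) ^ t * Real.exp (-‖y‖ ^ 2 / 2) ^ s
      * Real.exp (t * s / 2 * ‖x - y‖ ^ 2) = Real.exp (-‖t • x + s • y‖ ^ 2 / 2) := by
  obtain rfl : s = 1 - t := by linarith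
  rw [← Real.exp_mul, ← Real.exp_mul, ← Real.exp_add, ← Real.exp_add, norm_add_sq_real,
    norm_sub_sq_real, norm_smul, norm_smul, mul_pow, mul_pow, Real.norm_eq_abs, Real.norm_eq_abs,
    sq_abs, sq_abs, real_inner_smul_left, real_inner_smul_right]
  ring_nf

namespace IsHomogeneousLogConcave

variable {n : ℕ} {α : ℝ} {w : (𝔼 n) → ℝ}

lemma eq_zero_of_notMem (hw : IsHomogeneousLogConcave α w) {x : 𝔼 n} (hx : x ∉ support w) :
    w x = 0 :=
  le_antisymm (not_lt.1 hx) (hw.nonneg x)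

lemma measurable (hw : IsHomogeneousLogConcave α w) : Measurable w := by
  classical
  have hcont : ContinuousOn w (support w) :=
    (Real.continuous_exp.comp_continuousOn
      (hw.logConcave.continuousOn hw.isOpen_support)).congr fun x hx => (Real.exp_log hx).symm
  have hpiece : (support w).piecewise w (fun _ => 0) = w := by
    ext x
    by_cases hx : x ∈ support w <;> simp [hx, hw.eq_zero_of_notMem]
  exact hpiece ▸ hcont.measurable_piecewise continuousOn_const hw.isOpen_support.measurableSet

lemma smul_mem_support (hw : IsHomogeneousLogConcave α w) {t : ℝ} (ht : 0 < t) {x : 𝔼 n}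
    (hx : x ∈ support w) : t • x ∈ support w := by
  rw [support, Set.mem_ofPred_eq, hw.homogeneous t ht x hx]
  exact mul_pos (Real.rpow_pos_of_pos ht _) hx

lemma apply_smul (hw : IsHomogeneousLogConcave α w) {t : ℝ} (ht : 0 < t) (x : 𝔼 n) :
    w (t • x) = t ^ α * w x := by
  by_cases hx : x ∈ support w
  · exact hw.homogeneous t ht x hx
  · have htx : t • x ∉ support w := fun h => hx <| by
      simpa [smul_smul, ht.ne'] using hw.smul_mem_support (inv_pos.2 ht) h
    rw [hw.eq_zero_of_notMem hx, hw.eq_zero_of_notMem htx, mul_zero]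

lemma exists_le_exp (hw : IsHomogeneousLogConcave α w) :
    ∃ C, ∀ x, w x ≤ Real.exp (C * (1 + ‖x‖)) := by
  obtain ⟨C, hle⟩ := exists_le_mul_one_add_norm_of_concaveOn hw.logConcave hw.isOpen_support
    hw.nonempty_support
  refine ⟨C, fun x => ?_⟩
  by_cases hx : x ∈ support w
  · exact (Real.log_le_iff_le_exp hx).1 (hle x hx)
  · exact (hw.eq_zero_of_notMem hx).trans_le (Real.exp_nonneg _)

lemma rpow_mul_rpow_le (hw : IsHomogeneousLogConcave α w) {t s : ℝ} (ht : 0 < t) (hs : 0 < s)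
    (hts : t + s = 1) (x y : 𝔼 n) : w x ^ t * w y ^ s ≤ w (t • x + s • y) := by
  by_cases hx : x ∈ support w
  swap; · simp [hw.eq_zero_of_notMem hx, ht.ne', hw.nonneg]
  by_cases hy : y ∈ support w
  swap; · simp [hw.eq_zero_of_notMem hy, hs.ne', hw.nonneg]
  have hz : t • x + s • y ∈ support w := hw.logConcave.1 hx hy ht.le hs.le hts
  rw [Real.rpow_def_of_pos hx, Real.rpow_def_of_pos hy, ← Real.exp_add, ← Real.le_log_iff_exp_le hz,
    mul_comm _ t, mul_comm _ s]
  exact hw.logConcave.2 hx hy ht.le hs.le hts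

lemma nu_eq (hw : IsHomogeneousLogConcave α w) :
    nu w = volume.withDensity fun x => ENNReal.ofReal (w x) :=
  withDensity_restrict_of_eq_zero hw.isOpen_support.measurableSet fun x hx => by
    simp [hw.eq_zero_of_notMem hx]

lemma integral_nu (hw : IsHomogeneousLogConcave α w) (φ : (𝔼 n) → ℝ) :
    ∫ x, φ x ∂(nu w) = ∫ x, w x * φ x := by
  rw [hw.nu_eq, integral_withDensity_eq_integral_toReal_smul hw.measurable.ennreal_ofReal (by simp)]
  simp [ENNReal.toReal_ofReal (hw.nonneg _)]

lemma integrable_nu_iff (hw : IsHomogeneousLogConcave α w) {φ : (𝔼 n) → ℝ} :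
    Integrable φ (nu w) ↔ Integrable fun x => w x * φ x := by
  rw [hw.nu_eq,
    integrable_withDensity_iff_integrable_smul' hw.measurable.ennreal_ofReal (by simp)]
  simp [ENNReal.toReal_ofReal (hw.nonneg _)]

lemma isLocallyFiniteMeasure_nu (hw : IsHomogeneousLogConcave α w) :
    IsLocallyFiniteMeasure (nu w) := by
  obtain ⟨C, hle⟩ := hw.exists_le_exp
  have hcont : Continuous fun x : 𝔼 n => Real.exp (C * (1 + ‖x‖)) := by fun_prop
  have : IsLocallyFiniteMeasure
      ((volume : Measure (𝔼 n)).withDensity fun x => ENNReal.ofReal (Real.exp (C * (1 + ‖x‖)))) :=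
    IsLocallyFiniteMeasure.withDensity_ofReal hcont
  rw [hw.nu_eq]
  exact Measure.isLocallyFiniteMeasure_of_le
    (withDensity_mono (ae_of_all _ fun _ => ENNReal.ofReal_le_ofReal (hle _)))

lemma nu_ne_zero (hw : IsHomogeneousLogConcave α w) : nu w ≠ 0 := by
  intro h0
  have hae : ∀ᵐ _ ∂(volume.restrict (support w)), False := by
    filter_upwards [(withDensity_eq_zero_iff hw.measurable.ennreal_ofReal.aemeasurable).1 h0,
      ae_restrict_mem hw.isOpen_support.measurableSet] with x hx hxS
    exact (ENNReal.ofReal_pos.2 hxS).ne' hx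
  rw [eventually_false_iff_eq_bot, ae_eq_bot, Measure.restrict_eq_zero] at hae
  exact hw.isOpen_support.measure_ne_zero _ hw.nonempty_support hae

lemma integrable_nu_exp_neg (hw : IsHomogeneousLogConcave α w) {c : ℝ} (hc : 0 < c) :
    Integrable (fun x => Real.exp (-c * ‖x‖ ^ 2)) (nu w) := by
  obtain ⟨C, hle⟩ := hw.exists_le_exp
  have hbound (x : 𝔼 n) : w x * Real.exp (-c * ‖x‖ ^ 2)
      ≤ Real.exp (C + C ^ 2 / (2 * c)) * Real.exp (-(c / 2) * ‖x‖ ^ 2) := calc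
    _ ≤ Real.exp (C * (1 + ‖x‖)) * Real.exp (-c * ‖x‖ ^ 2) := by gcongr; exact hle x
    _ ≤ _ := by
      rw [← Real.exp_add, ← Real.exp_add, Real.exp_le_exp]
      have hsq : C + C ^ 2 / (2 * c) + -(c / 2) * ‖x‖ ^ 2 - (C * (1 + ‖x‖) + -c * ‖x‖ ^ 2)
          = (C - c * ‖x‖) ^ 2 / (2 * c) := by field_simp; ring
      have : 0 ≤ (C - c * ‖x‖) ^ 2 / (2 * c) := by positivity
      linarith
  refine hw.integrable_nu_iff.2 <| ((integrable_exp_neg_mul_sq_norm (half_pos hc)).const_mul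
    (Real.exp (C + C ^ 2 / (2 * c)))).mono' (hw.measurable.mul (by fun_prop)).aestronglyMeasurable
    (ae_of_all _ fun x => ?_)
  rw [Real.norm_of_nonneg (mul_nonneg (hw.nonneg x) (Real.exp_nonneg _))]
  exact hbound x

lemma integrable_nu_of_le (hw : IsHomogeneousLogConcave α w) {F : Type*} [NormedAddCommGroup F]
    {φ : (𝔼 n) → F} (hφ : AEStronglyMeasurable φ (nu w)) {K c : ℝ} (hc : 0 < c)
    (hle : ∀ x, ‖φ x‖ ≤ K * Real.exp (-c * ‖x‖ ^ 2)) : Integrable φ (nu w) :=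
  ((hw.integrable_nu_exp_neg hc).const_mul K).mono' hφ (ae_of_all _ hle)

lemma integrable_nu_gauss (hw : IsHomogeneousLogConcave α w) :
    Integrable (fun x => Real.exp (-‖x‖ ^ 2 / 2)) (nu w) := by
  convert hw.integrable_nu_exp_neg one_half_pos using 3
  ring

lemma integral_nu_gauss_pos (hw : IsHomogeneousLogConcave α w) :
    0 < ∫ x, Real.exp (-‖x‖ ^ 2 / 2) ∂(nu w) :=
  have : NeZero (nu w) := ⟨hw.nu_ne_zero⟩
  integral_exp_pos hw.integrable_nu_gauss

lemma normConst_eq (hw : IsHomogeneousLogConcave α w) :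
    normConst w = (∫ x, Real.exp (-‖x‖ ^ 2 / 2) ∂(nu w))⁻¹ := by
  rw [normConst, hw.integral_nu, setIntegral_eq_integral_of_forall_compl_eq_zero fun x hx => ?_]
  rw [hw.eq_zero_of_notMem hx, zero_mul]

lemma normConst_pos (hw : IsHomogeneousLogConcave α w) : 0 < normConst w :=
  hw.normConst_eq ▸ inv_pos.2 hw.integral_nu_gauss_pos

lemma mu_eq_withDensity_volume (hw : IsHomogeneousLogConcave α w) :
    mu w = volume.withDensity
      fun x => ENNReal.ofReal (normConst w * (w x * Real.exp (-‖x‖ ^ 2 / 2))) :=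
  withDensity_restrict_of_eq_zero hw.isOpen_support.measurableSet fun x hx => by
    simp [hw.eq_zero_of_notMem hx]

lemma mu_eq_withDensity_nu (hw : IsHomogeneousLogConcave α w) :
    mu w = (nu w).withDensity
      fun x => ENNReal.ofReal (normConst w * Real.exp (-‖x‖ ^ 2 / 2)) := by
  rw [mu, nu, ← withDensity_mul _ hw.measurable.ennreal_ofReal (by fun_prop)]
  congr with x
  rw [Pi.mul_apply, ← ENNReal.ofReal_mul (hw.nonneg x), mul_left_comm]

lemma lintegral_mu (hw : IsHomogeneousLogConcave α w) (φ : (𝔼 n) → ℝ≥0∞) :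
    ∫⁻ x, φ x ∂(mu w) =
      ∫⁻ x, ENNReal.ofReal (normConst w * Real.exp (-‖x‖ ^ 2 / 2)) * φ x ∂(nu w) := by
  rw [hw.mu_eq_withDensity_nu,
    lintegral_withDensity_eq_lintegral_mul_non_measurable _ (by fun_prop) (by simp)]
  rfl

lemma integral_mu (hw : IsHomogeneousLogConcave α w) (φ : (𝔼 n) → ℝ) :
    ∫ x, φ x ∂(mu w) = normConst w * ∫ x, Real.exp (-‖x‖ ^ 2 / 2) * φ x ∂(nu w) := by
  have hpos (x : 𝔼 n) : 0 ≤ normConst w * Real.exp (-‖x‖ ^ 2 / 2) :=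
    mul_nonneg hw.normConst_pos.le (Real.exp_nonneg _)
  rw [hw.mu_eq_withDensity_nu,
    integral_withDensity_eq_integral_toReal_smul (by fun_prop) (by simp), ← integral_const_mul]
  simp only [ENNReal.toReal_ofReal (hpos _), smul_eq_mul, mul_assoc]

lemma isProbabilityMeasure_mu (hw : IsHomogeneousLogConcave α w) :
    IsProbabilityMeasure (mu w) := by
  constructor
  rw [← lintegral_one, hw.lintegral_mu]
  simp only [mul_one]
  rw [← ofReal_integral_eq_lintegral_ofReal (hw.integrable_nu_gauss.const_mul _)
    (ae_of_all _ fun x => mul_nonneg hw.normConst_pos.le (Real.exp_nonneg _)),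
    integral_const_mul, hw.normConst_eq, inv_mul_cancel₀ hw.integral_nu_gauss_pos.ne',
    ENNReal.ofReal_one]

lemma gaussianPrekopaLeindler_mu (hw : IsHomogeneousLogConcave α w) :
    GaussianPrekopaLeindler (mu w) := by
  have hmass := hw.isProbabilityMeasure_mu.measure_univ
  rw [hw.mu_eq_withDensity_volume] at hmass ⊢
  rw [withDensity_apply _ .univ, Measure.restrict_univ] at hmass
  refine gaussianPrekopaLeindler_withDensity
    (fun t s ht hs hts => prekopaLeindler_euclideanSpace ht hs hts n)
    (hw.measurable.mul (by fun_prop) |>.const_mul _ |>.ennreal_ofReal) hmass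
    fun t s ht hs hts x y => ?_
  have hC := hw.normConst_pos.le
  have hwx := hw.nonneg x
  have hwy := hw.nonneg y
  rw [ENNReal.ofReal_rpow_of_nonneg (by positivity) ht.le,
    ENNReal.ofReal_rpow_of_nonneg (by positivity) hs.le, ← ENNReal.ofReal_mul (by positivity),
    ← ENNReal.ofReal_mul (by positivity)]
  refine ENNReal.ofReal_le_ofReal ?_
  have hconst : normConst w ^ t * normConst w ^ s = normConst w := by
    rw [← Real.rpow_add hw.normConst_pos, hts, Real.rpow_one]
  calc _ = normConst w ^ t * normConst w ^ s * (w x ^ t * w y ^ s *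
        (Real.exp (-‖x‖ ^ 2 / 2) ^ t * Real.exp (-‖y‖ ^ 2 / 2) ^ s
          * Real.exp (t * s / 2 * ‖x - y‖ ^ 2))) := by
        rw [Real.mul_rpow hC (by positivity), Real.mul_rpow hC (by positivity),
          Real.mul_rpow hwx (by positivity), Real.mul_rpow hwy (by positivity)]
        ring
    _ = normConst w * (w x ^ t * w y ^ s * Real.exp (-‖t • x + s • y‖ ^ 2 / 2)) := by
        rw [hconst, exp_rpow_mul_exp_rpow_mul_exp hts]
    _ ≤ _ := by gcongr; exact hw.rpow_mul_rpow_le ht hs hts x y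

lemma integral_comp_smul_nu (hw : IsHomogeneousLogConcave α w) (φ : (𝔼 n) → ℝ) {t : ℝ}
    (ht : 0 < t) : ∫ x, φ (t • x) ∂(nu w) = t ^ (-(n + α)) * ∫ x, φ x ∂(nu w) := by
  have hweight (x : 𝔼 n) : w x * φ (t • x) = t ^ (-α) * (w (t • x) * φ (t • x)) := by
    rw [hw.apply_smul ht, ← mul_assoc, ← mul_assoc, ← Real.rpow_add ht]
    simp
  simp_rw [hw.integral_nu, hweight]
  rw [integral_const_mul, Measure.integral_comp_smul volume (fun x => w x * φ x),
    finrank_euclideanSpace_fin, abs_of_pos (by positivity), smul_eq_mul, ← mul_assoc, neg_add,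
    Real.rpow_add ht, Real.rpow_neg ht.le, Real.rpow_neg ht.le, Real.rpow_natCast,
    mul_comm (t ^ n)⁻¹]

/-- Euler's identity for the homogeneous measure `ν`: differentiate the scaling relation
`integral_comp_smul_nu` at `t = 1`. -/
lemma integral_fderiv_apply_self (hw : IsHomogeneousLogConcave α w) {φ : (𝔼 n) → ℝ}
    (hφ : ContDiff ℝ 1 φ) (hφi : Integrable φ (nu w)) {b : (𝔼 n) → ℝ} (hb : Integrable b (nu w))
    (hle : ∀ x, ∀ t ∈ Metric.ball (1 : ℝ) (1 / 2), |fderiv ℝ φ (t • x) x| ≤ b x) :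
    ∫ x, fderiv ℝ φ x x ∂(nu w) = -(n + α) * ∫ x, φ x ∂(nu w) := by
  have hφ' : Continuous (fderiv ℝ φ) := hφ.continuous_fderiv (by simp)
  have hray (x : 𝔼 n) (t : ℝ) : HasDerivAt (fun t : ℝ => φ (t • x)) (fderiv ℝ φ (t • x) x) t :=
    (hφ.differentiable (by simp) (t • x)).hasFDerivAt.comp_hasDerivAt t
      (by simpa using (hasDerivAt_id t).smul_const x)
  obtain ⟨-, hleft⟩ := hasDerivAt_integral_of_dominated_loc_of_deriv_le (μ := nu w)
    (F := fun (t : ℝ) x => φ (t • x)) (F' := fun t x => fderiv ℝ φ (t • x) x) (x₀ := 1)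
    (Metric.ball_mem_nhds 1 (by norm_num : (0 : ℝ) < 1 / 2))
    (Eventually.of_forall fun t => (hφ.continuous.comp (by fun_prop)).aestronglyMeasurable)
    (by simpa using hφi)
    ((hφ'.comp (by fun_prop)).clm_apply continuous_id).aestronglyMeasurable
    (ae_of_all _ fun x t ht => hle x t ht) hb (ae_of_all _ fun x t _ => hray x t)
  have hright : HasDerivAt (fun t : ℝ => t ^ (-(n + α)) * ∫ x, φ x ∂(nu w))
      (-(n + α) * ∫ x, φ x ∂(nu w)) 1 := by
    simpa using (Real.hasDerivAt_rpow_const (x := 1) (p := -(n + α)) (Or.inl one_ne_zero)).mul_const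
      (∫ x, φ x ∂(nu w))
  have hscale : (fun t : ℝ => t ^ (-(n + α)) * ∫ x, φ x ∂(nu w))
      =ᶠ[𝓝 1] fun t => ∫ x, φ (t • x) ∂(nu w) := by
    filter_upwards [eventually_gt_nhds (zero_lt_one' ℝ)] with t ht
    exact (hw.integral_comp_smul_nu φ ht).symm
  simpa using (hleft.congr_of_eventuallyEq hscale).unique hright

end IsHomogeneousLogConcave

section Gradient

variable {E : Type*} [NormedAddCommGroup E] [InnerProductSpace ℝ E] [CompleteSpace E]

lemma hasGradientAt_mul {f g : E → ℝ} {f' g' x : E} (hf : HasGradientAt f f' x)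
    (hg : HasGradientAt g g' x) : HasGradientAt (fun x => f x * g x) (f x • g' + g x • f') x := by
  rw [hasGradientAt_iff_hasFDerivAt] at *
  exact (hf.mul hg).congr_fderiv (by simp)

lemma hasGradientAt_comp {f : E → ℝ} {f' x : E} {ψ : ℝ → ℝ} {c : ℝ} (hψ : HasDerivAt ψ c (f x))
    (hf : HasGradientAt f f' x) : HasGradientAt (fun x => ψ (f x)) (c • f') x := by
  rw [hasGradientAt_iff_hasFDerivAt] at *
  exact (hψ.comp_hasFDerivAt x hf).congr_fderiv (by simp)

lemma hasGradientAt_norm_sq (x : E) : HasGradientAt (fun x : E => ‖x‖ ^ 2) ((2 : ℝ) • x) x := by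
  rw [hasGradientAt_iff_hasFDerivAt]
  refine (hasStrictFDerivAt_norm_sq x).hasFDerivAt.congr_fderiv ?_
  ext y
  simp

lemma hasGradientAt_comp_norm_sq {ψ : ℝ → ℝ} {c : ℝ} {x : E} (hψ : HasDerivAt ψ c (‖x‖ ^ 2)) :
    HasGradientAt (fun x : E => ψ (‖x‖ ^ 2)) ((2 * c) • x) x := by
  simpa only [smul_smul, mul_comm c] using
    hasGradientAt_comp (f := fun x : E => ‖x‖ ^ 2) hψ (hasGradientAt_norm_sq x)

lemma hasGradientAt_comp_smul {f : E → ℝ} {t : ℝ} {x : E} (hf : DifferentiableAt ℝ f (t • x)) :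
    HasGradientAt (fun x => f (t • x)) (t • gradient f (t • x)) x := by
  rw [hasGradientAt_iff_hasFDerivAt]
  refine (hf.hasFDerivAt.comp x ((hasFDerivAt_id x).const_smul t)).congr_fderiv ?_
  ext y
  simp

lemma norm_gradient (f : E → ℝ) (x : E) : ‖gradient f x‖ = ‖fderiv ℝ f x‖ := by
  simp [gradient]

lemma continuous_gradient {f : E → ℝ} (hf : ContDiff ℝ 1 f) : Continuous (gradient f) :=
  (InnerProductSpace.toDual ℝ E).symm.continuous.comp (hf.continuous_fderiv (by simp))

lemma hasCompactSupport_gradient {f : E → ℝ} (hf : HasCompactSupport f) :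
    HasCompactSupport (gradient f) :=
  (hf.fderiv ℝ).comp_left (g := (InnerProductSpace.toDual ℝ E).symm) (by simp)

end Gradient

lemma exists_abs_fderiv_smul_apply_le {E : Type*} [NormedAddCommGroup E] [NormedSpace ℝ E]
    {φ : E → ℝ} (hφ : ContDiff ℝ 1 φ) (hφc : HasCompactSupport φ) :
    ∃ K R : ℝ, ∀ x, ∀ t ∈ Metric.ball (1 : ℝ) (1 / 2),
      |fderiv ℝ φ (t • x) x| ≤ (Metric.closedBall (0 : E) R).indicator (fun _ => K) x := by
  obtain ⟨R, hR⟩ := (hφc.fderiv ℝ).isCompact.isBounded.subset_closedBall 0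
  obtain ⟨K, hK⟩ := (hφc.fderiv ℝ).exists_bound_of_continuous (hφ.continuous_fderiv (by simp))
  have hK₀ : 0 ≤ K := (norm_nonneg _).trans (hK 0)
  refine ⟨K * (2 * R), 2 * R, fun x t ht => ?_⟩
  rw [Metric.mem_ball, Real.dist_eq, abs_lt] at ht
  by_cases htx : t • x ∈ tsupport (fderiv ℝ φ)
  · have hxR : ‖x‖ ≤ 2 * R := by
      have := hR htx
      rw [mem_closedBall_zero_iff, norm_smul, Real.norm_of_nonneg (by linarith)] at this
      nlinarith [norm_nonneg x]
    rw [Set.indicator_of_mem (by simpa using hxR)]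
    exact ((fderiv ℝ φ (t • x)).le_opNorm x).trans (mul_le_mul (hK _) hxR (norm_nonneg _) hK₀)
  · rw [image_eq_zero_of_notMem_tsupport htx, zero_apply, abs_zero]
    refine Set.indicator_nonneg (fun y hy => ?_) x
    have : 0 ≤ 2 * R := (norm_nonneg y).trans (by simpa using hy)
    positivity

section GaussianLift

variable {E : Type*} [NormedAddCommGroup E]

/-- The function `f e^{|x|²/4}`. The square of this factor is, up to the constant `C_w`, the inverse
of the density of `μ_w` with respect to `ν`, so that the lift carries `L²(ν)` to `L²(μ_w)`. -/
def gaussianLift (f : E → ℝ) (x : E) : ℝ := f x * Real.exp (‖x‖ ^ 2 / 4)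

lemma gaussianLift_sq (f : E → ℝ) (x : E) :
    gaussianLift f x ^ 2 = Real.exp (‖x‖ ^ 2 / 2) * f x ^ 2 := by
  rw [gaussianLift, mul_pow, ← Real.exp_nat_mul, mul_comm]
  ring_nf

lemma gaussianLift_sq_mul_log (f : E → ℝ) (x : E) :
    gaussianLift f x ^ 2 * Real.log (gaussianLift f x ^ 2) =
      Real.exp (‖x‖ ^ 2 / 2) * (f x ^ 2 * Real.log (f x ^ 2) + 1 / 2 * (f x ^ 2 * ‖x‖ ^ 2)) := by
  rw [gaussianLift_sq]
  rcases eq_or_ne (f x) 0 with hfx | hfx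
  · simp [hfx]
  · rw [Real.log_mul (by positivity) (by positivity), Real.log_exp]
    ring

variable [InnerProductSpace ℝ E]

lemma contDiff_gaussianLift {f : E → ℝ} {k : WithTop ℕ∞} (hf : ContDiff ℝ k f) :
    ContDiff ℝ k (gaussianLift f) :=
  hf.mul ((contDiff_norm_sq ℝ).div_const 4).exp

lemma norm_gradient_gaussianLift_sq [CompleteSpace E] {f : E → ℝ} {x : E}
    (hf : DifferentiableAt ℝ f x) :
    ‖gradient (gaussianLift f) x‖ ^ 2 = Real.exp (‖x‖ ^ 2 / 2) *
      (‖gradient f x‖ ^ 2 + f x * inner ℝ (gradient f x) x + 1 / 4 * (f x ^ 2 * ‖x‖ ^ 2)) := by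
  have hexp : HasDerivAt (fun r : ℝ => Real.exp (r / 4)) (Real.exp (‖x‖ ^ 2 / 4) * (1 / 4))
      (‖x‖ ^ 2) := ((hasDerivAt_id' _).div_const 4).exp
  have hgrad : gradient (gaussianLift f) x =
      Real.exp (‖x‖ ^ 2 / 4) • (gradient f x + (f x / 2) • x) := by
    refine (hasGradientAt_mul hf.hasGradientAt (hasGradientAt_comp_norm_sq hexp)).gradient.trans ?_
    module
  rw [hgrad, norm_smul, Real.norm_of_nonneg (Real.exp_nonneg _), mul_pow, ← Real.exp_nat_mul,
    norm_add_sq_real, real_inner_smul_right, norm_smul, mul_pow, Real.norm_eq_abs, sq_abs]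
  ring_nf

end GaussianLift

section Truncation

/-- A smooth truncation of the identity, which vanishes for `|r| ≤ 1 / 2` and is equal to `r` for
`1 ≤ |r|`. Composing with it removes the small values of a function, where `r² log r²` is
negative. -/
def truncation (r : ℝ) : ℝ := r * Real.smoothTransition (4 * r ^ 2 - 1)

lemma contDiff_truncation : ContDiff ℝ 2 truncation :=
  contDiff_id.mul ((Real.smoothTransition.contDiff (n := 2)).comp (by fun_prop))

lemma truncation_eq_self {r : ℝ} (hr : 1 ≤ r ^ 2) : truncation r = r := by
  rw [truncation, Real.smoothTransition.one_of_one_le (by linarith), mul_one]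

lemma truncation_eq_zero {r : ℝ} (hr : 4 * r ^ 2 ≤ 1) : truncation r = 0 := by
  rw [truncation, Real.smoothTransition.zero_of_nonpos (by linarith), mul_zero]

lemma truncation_sq_le (r : ℝ) : truncation r ^ 2 ≤ r ^ 2 := by
  rw [truncation, mul_pow]
  exact mul_le_of_le_one_right (sq_nonneg r)
    (pow_le_one₀ (Real.smoothTransition.nonneg _) (Real.smoothTransition.le_one _))

lemma exists_abs_deriv_truncation_le : ∃ L, ∀ r, |deriv truncation r| ≤ L := by
  have hsupp : HasCompactSupport fun r => truncation r - r := by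
    refine .of_support_subset_isCompact (isCompact_Icc (a := -1) (b := 1)) fun r hr => ?_
    by_contra h
    refine hr (sub_eq_zero.2 (truncation_eq_self ?_))
    rw [Set.mem_Icc, ← abs_le, not_le] at h
    exact ((one_lt_sq_iff_one_lt_abs r).2 h).le
  have hdiff : ContDiff ℝ 1 fun r => truncation r - r :=
    (contDiff_truncation.of_le (by norm_num)).sub contDiff_id
  obtain ⟨L, hL⟩ := hsupp.deriv.exists_bound_of_continuous (hdiff.continuous_deriv le_rfl)
  refine ⟨L + 1, fun r => ?_⟩
  have hr := hL r
  rw [deriv_fun_sub (contDiff_truncation.differentiable (by simp) r) differentiableAt_fun_id,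
    deriv_id'', Real.norm_eq_abs] at hr
  calc |deriv truncation r| = |deriv truncation r - 1 + 1| := by rw [sub_add_cancel]
    _ ≤ |deriv truncation r - 1| + |(1 : ℝ)| := abs_add_le _ _
    _ ≤ L + 1 := by rw [abs_one]; gcongr

lemma max_zero_mul_log_sq_le (r : ℝ) : max 0 (r ^ 2 * Real.log (r ^ 2)) ≤
    truncation r ^ 2 * Real.log (truncation r ^ 2) + 4 * r ^ 2 := by
  rcases le_total 1 (r ^ 2) with hr | hr
  · rw [truncation_eq_self hr, max_eq_right (mul_nonneg (sq_nonneg r) (Real.log_nonneg hr))]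
    linarith
  · rw [max_eq_left (mul_nonpos_of_nonneg_of_nonpos (sq_nonneg r)
      (Real.log_nonpos (sq_nonneg r) hr))]
    rcases le_total (4 * r ^ 2) 1 with hr' | hr'
    · rw [truncation_eq_zero hr']
      simp only [ne_eq, OfNat.ofNat_ne_zero, not_false_eq_true, zero_pow, Real.log_zero, mul_zero,
        zero_add]
      positivity
    · linarith [Real.self_sub_one_le_mul_log (sq_nonneg (truncation r)), sq_nonneg (truncation r)]

end Truncation

namespace IsHomogeneousLogConcave

variable {n : ℕ} {α : ℝ} {w : (𝔼 n) → ℝ}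

lemma integrable_nu_of_hasCompactSupport (hw : IsHomogeneousLogConcave α w) {φ : (𝔼 n) → ℝ}
    (hφ : Continuous φ) (hφc : HasCompactSupport φ) : Integrable φ (nu w) :=
  have := hw.isLocallyFiniteMeasure_nu
  hφ.integrable_of_hasCompactSupport hφc

lemma integrable_sq_mul_log_sq (hw : IsHomogeneousLogConcave α w) {f : (𝔼 n) → ℝ}
    (hf : Continuous f) (hfc : HasCompactSupport f) :
    Integrable (fun x => f x ^ 2 * Real.log (f x ^ 2)) (nu w) :=
  hw.integrable_nu_of_hasCompactSupport (Real.continuous_mul_log.comp (hf.pow 2))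
    (hfc.comp_left (g := fun r : ℝ => r ^ 2 * Real.log (r ^ 2)) (by simp))

lemma integrable_sq (hw : IsHomogeneousLogConcave α w) {f : (𝔼 n) → ℝ}
    (hf : Continuous f) (hfc : HasCompactSupport f) : Integrable (fun x => f x ^ 2) (nu w) :=
  hw.integrable_nu_of_hasCompactSupport (hf.pow 2)
    (hfc.comp_left (g := fun r : ℝ => r ^ 2) (by simp))

lemma integrable_norm_gradient_sq (hw : IsHomogeneousLogConcave α w) {f : (𝔼 n) → ℝ}
    (hf : ContDiff ℝ 1 f) (hfc : HasCompactSupport f) :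
    Integrable (fun x => ‖gradient f x‖ ^ 2) (nu w) :=
  hw.integrable_nu_of_hasCompactSupport ((continuous_gradient hf).norm.pow 2)
    ((hasCompactSupport_gradient hfc).comp_left (g := fun v : 𝔼 n => ‖v‖ ^ 2) (by simp))

lemma integrable_sq_mul_norm_sq (hw : IsHomogeneousLogConcave α w) {f : (𝔼 n) → ℝ}
    (hf : Continuous f) (hfc : HasCompactSupport f) :
    Integrable (fun x => f x ^ 2 * ‖x‖ ^ 2) (nu w) :=
  hw.integrable_nu_of_hasCompactSupport (by fun_prop)
    (hfc.comp_left (g := fun r : ℝ => r ^ 2) (by simp)).mul_right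

lemma integrable_mul_inner_gradient (hw : IsHomogeneousLogConcave α w) {f : (𝔼 n) → ℝ}
    (hf : ContDiff ℝ 1 f) (hfc : HasCompactSupport f) :
    Integrable (fun x => f x * inner ℝ (gradient f x) x) (nu w) := by
  have hf_cont := hf.continuous
  have hgrad_cont := continuous_gradient hf
  exact hw.integrable_nu_of_hasCompactSupport (by fun_prop) hfc.mul_right

lemma integral_mul_inner_gradient (hw : IsHomogeneousLogConcave α w) {f : (𝔼 n) → ℝ}
    (hf : ContDiff ℝ 1 f) (hfc : HasCompactSupport f) :
    ∫ x, f x * inner ℝ (gradient f x) x ∂(nu w) = -((n + α) / 2) * ∫ x, f x ^ 2 ∂(nu w) := by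
  have := hw.isLocallyFiniteMeasure_nu
  have hsq : ContDiff ℝ 1 fun x => f x ^ 2 := hf.pow 2
  obtain ⟨K, R, hle⟩ := exists_abs_fderiv_smul_apply_le hsq
    (hfc.comp_left (g := fun r : ℝ => r ^ 2) (by simp))
  have hbound : Integrable ((Metric.closedBall (0 : 𝔼 n) R).indicator fun _ => K) (nu w) := by
    rw [integrable_indicator_iff Metric.isClosed_closedBall.measurableSet]
    exact integrableOn_const (isCompact_closedBall _ _).measure_lt_top.ne
  have hfderiv (x : 𝔼 n) :
      fderiv ℝ (fun x => f x ^ 2) x x = 2 * (f x * inner ℝ (gradient f x) x) := by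
    rw [((hf.differentiable (by simp) x).hasFDerivAt.pow 2).fderiv, inner_gradient_left]
    simp only [Nat.add_one_sub_one, pow_one, nsmul_eq_mul, Nat.cast_ofNat,
      smul_apply, smul_eq_mul]
    ring
  have hEuler :=
    hw.integral_fderiv_apply_self hsq (hw.integrable_sq hf.continuous hfc) hbound hle
  simp_rw [hfderiv] at hEuler
  rw [integral_const_mul] at hEuler
  linarith

lemma integral_mu_exp_mul (hw : IsHomogeneousLogConcave α w) (φ : (𝔼 n) → ℝ) :
    ∫ x, Real.exp (‖x‖ ^ 2 / 2) * φ x ∂(mu w) = normConst w * ∫ x, φ x ∂(nu w) := by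
  rw [hw.integral_mu]
  congr 2 with x
  rw [← mul_assoc, ← Real.exp_add, neg_div, neg_add_cancel, Real.exp_zero, one_mul]

lemma entropy_mu_gaussianLift_sq (hw : IsHomogeneousLogConcave α w) {f : (𝔼 n) → ℝ}
    (hf : Continuous f) (hfc : HasCompactSupport f) :
    entropy (mu w) (fun x => gaussianLift f x ^ 2) =
      normConst w * (entropy (nu w) (fun x => f x ^ 2)
        - Real.log (normConst w) * (∫ x, f x ^ 2 ∂(nu w))
        + 1 / 2 * ∫ x, f x ^ 2 * ‖x‖ ^ 2 ∂(nu w)) := by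
  simp only [entropy, gaussianLift_sq_mul_log]
  simp only [gaussianLift_sq]
  rw [hw.integral_mu_exp_mul, hw.integral_mu_exp_mul (fun x => f x ^ 2),
    integral_add (hw.integrable_sq_mul_log_sq hf hfc)
      ((hw.integrable_sq_mul_norm_sq hf hfc).const_mul _), integral_const_mul]
  rcases eq_or_ne (∫ x, f x ^ 2 ∂(nu w)) 0 with hmass | hmass
  · simp [hmass]
  · rw [Real.log_mul hw.normConst_pos.ne' hmass]
    ring

lemma integral_mu_norm_gradient_gaussianLift_sq (hw : IsHomogeneousLogConcave α w)
    {f : (𝔼 n) → ℝ} (hf : ContDiff ℝ 1 f) (hfc : HasCompactSupport f) :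
    ∫ x, ‖gradient (gaussianLift f) x‖ ^ 2 ∂(mu w) =
      normConst w * ((∫ x, ‖gradient f x‖ ^ 2 ∂(nu w)) - (n + α) / 2 * (∫ x, f x ^ 2 ∂(nu w))
        + 1 / 4 * ∫ x, f x ^ 2 * ‖x‖ ^ 2 ∂(nu w)) := by
  have hgrad := hw.integrable_norm_gradient_sq hf hfc
  have hinner := hw.integrable_mul_inner_gradient hf hfc
  simp only [norm_gradient_gaussianLift_sq (hf.differentiable one_ne_zero _)]
  rw [hw.integral_mu_exp_mul, integral_add (hgrad.fun_add hinner)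
      ((hw.integrable_sq_mul_norm_sq hf.continuous hfc).const_mul _),
    integral_add hgrad hinner, hw.integral_mul_inner_gradient hf hfc, integral_const_mul]
  ring

lemma entropy_nu_sq_le (hw : IsHomogeneousLogConcave α w) {f : (𝔼 n) → ℝ}
    (hf : ContDiff ℝ 2 f) (hfc : HasCompactSupport f) :
    entropy (nu w) (fun x => f x ^ 2) ≤
      (Real.log (normConst w) - (n + α)) * (∫ x, f x ^ 2 ∂(nu w))
        + 2 * ∫ x, ‖gradient f x‖ ^ 2 ∂(nu w) := by
  have := hw.isProbabilityMeasure_mu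
  have hlsi := entropy_sq_le hw.gaussianPrekopaLeindler_mu (contDiff_gaussianLift hf) hfc.mul_right
  simp only [← norm_gradient] at hlsi
  rw [hw.entropy_mu_gaussianLift_sq hf.continuous hfc,
    hw.integral_mu_norm_gradient_gaussianLift_sq (hf.of_le (by norm_num)) hfc,
    mul_left_comm 2] at hlsi
  linarith [le_of_mul_le_mul_left hlsi hw.normConst_pos]

lemma entropy_nu_sq_comp_smul (hw : IsHomogeneousLogConcave α w) (f : (𝔼 n) → ℝ) {t : ℝ}
    (ht : 0 < t) : entropy (nu w) (fun x => f (t • x) ^ 2) =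
      t ^ (-(n + α)) * (entropy (nu w) (fun x => f x ^ 2)
        + (n + α) * Real.log t * ∫ x, f x ^ 2 ∂(nu w)) := by
  simp only [entropy]
  rw [hw.integral_comp_smul_nu (fun x => f x ^ 2 * Real.log (f x ^ 2)) ht,
    hw.integral_comp_smul_nu (fun x => f x ^ 2) ht]
  rcases eq_or_ne (∫ x, f x ^ 2 ∂(nu w)) 0 with hmass | hmass
  · simp [hmass]
  · rw [Real.log_mul (Real.rpow_pos_of_pos ht _).ne' hmass, Real.log_rpow ht]
    ring

lemma entropy_nu_sq_le_of_pos (hw : IsHomogeneousLogConcave α w) {f : (𝔼 n) → ℝ}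
    (hf : ContDiff ℝ 2 f) (hfc : HasCompactSupport f) {t : ℝ} (ht : 0 < t) :
    entropy (nu w) (fun x => f x ^ 2) ≤
      (Real.log (normConst w) - (n + α) - (n + α) * Real.log t) * (∫ x, f x ^ 2 ∂(nu w))
        + 2 * t ^ 2 * ∫ x, ‖gradient f x‖ ^ 2 ∂(nu w) := by
  have hlsi := hw.entropy_nu_sq_le (f := fun x => f (t • x)) (hf.comp (contDiff_const_smul t))
    (hfc.comp_smul ht.ne')
  have hgrad (x : 𝔼 n) :
      ‖gradient (fun x => f (t • x)) x‖ ^ 2 = t ^ 2 * ‖gradient f (t • x)‖ ^ 2 := by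
    rw [(hasGradientAt_comp_smul (hf.differentiable (by simp) _)).gradient, norm_smul, mul_pow,
      Real.norm_eq_abs, sq_abs]
  simp only [hgrad] at hlsi
  rw [integral_const_mul, hw.entropy_nu_sq_comp_smul f ht,
    hw.integral_comp_smul_nu (fun x => f x ^ 2) ht,
    hw.integral_comp_smul_nu (fun x => ‖gradient f x‖ ^ 2) ht] at hlsi
  have hscale : 0 < t ^ (-(n + α)) := Real.rpow_pos_of_pos ht _
  refine le_of_mul_le_mul_left ?_ hscale
  linear_combination hlsi

lemma integral_norm_gradient_comp_sq_le (hw : IsHomogeneousLogConcave α w) {f : (𝔼 n) → ℝ}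
    (hf : ContDiff ℝ 1 f) (hfc : HasCompactSupport f) {ψ : ℝ → ℝ} (hψ : Differentiable ℝ ψ) {L : ℝ}
    (hL : ∀ r, |deriv ψ r| ≤ L) :
    ∫ x, ‖gradient (fun x => ψ (f x)) x‖ ^ 2 ∂(nu w) ≤
      L ^ 2 * ∫ x, ‖gradient f x‖ ^ 2 ∂(nu w) := by
  rw [← integral_const_mul]
  refine integral_mono_of_nonneg (ae_of_all _ fun x => sq_nonneg _)
    ((hw.integrable_norm_gradient_sq hf hfc).const_mul _) (ae_of_all _ fun x => ?_)
  dsimp only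
  rw [(hasGradientAt_comp (hψ (f x)).hasDerivAt
    (hf.differentiable one_ne_zero x).hasGradientAt).gradient, norm_smul, mul_pow]
  gcongr
  exact hL _

lemma entPos_nu_sq_le_integral_truncation (hw : IsHomogeneousLogConcave α w) {f : (𝔼 n) → ℝ}
    (hf : Continuous f) (hfc : HasCompactSupport f) :
    entPos (nu w) (fun x => f x ^ 2) ≤ ENNReal.ofReal
      ((∫ x, truncation (f x) ^ 2 * Real.log (truncation (f x) ^ 2) ∂(nu w))
        + 4 * ∫ x, f x ^ 2 ∂(nu w)) := by
  have hpos (x : 𝔼 n) := max_le_iff.1 (max_zero_mul_log_sq_le (f x))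
  have hentropy : Integrable (fun x => truncation (f x) ^ 2 * Real.log (truncation (f x) ^ 2))
      (nu w) := hw.integrable_sq_mul_log_sq (contDiff_truncation.continuous.comp hf)
    (hfc.comp_left (g := truncation) (by simp [truncation]))
  have hsq := (hw.integrable_sq hf hfc).const_mul 4
  rw [← integral_const_mul, ← integral_add hentropy hsq,
    ofReal_integral_eq_lintegral_ofReal (hentropy.fun_add hsq) (ae_of_all _ fun x => (hpos x).1)]
  exact lintegral_mono fun x => ENNReal.ofReal_le_ofReal (hpos x).2

lemma entPos_nu_sq_le (hw : IsHomogeneousLogConcave α w) :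
    ∃ a b : ℝ, ∀ f : (𝔼 n) → ℝ, ContDiff ℝ 2 f → HasCompactSupport f →
      entPos (nu w) (fun x => f x ^ 2) ≤ ENNReal.ofReal ((∫ x, f x ^ 2 ∂(nu w)) ^ 2
        + a * (∫ x, f x ^ 2 ∂(nu w)) + b * ∫ x, ‖gradient f x‖ ^ 2 ∂(nu w)) := by
  obtain ⟨L, hL⟩ := exists_abs_deriv_truncation_le
  refine ⟨|Real.log (normConst w) - (n + α)| + 4, 2 * L ^ 2, fun f hf hfc => ?_⟩
  have htrunc : ContDiff ℝ 2 fun x => truncation (f x) := contDiff_truncation.comp hf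
  have htruncc : HasCompactSupport fun x => truncation (f x) :=
    hfc.comp_left (g := truncation) (by simp [truncation])
  refine (hw.entPos_nu_sq_le_integral_truncation hf.continuous hfc).trans
    (ENNReal.ofReal_le_ofReal ?_)
  have hlsi := hw.entropy_nu_sq_le htrunc htruncc
  have hgrad := hw.integral_norm_gradient_comp_sq_le (hf.of_le (by norm_num)) hfc
    (contDiff_truncation.differentiable two_ne_zero) hL
  have hmass_le : ∫ x, truncation (f x) ^ 2 ∂(nu w) ≤ ∫ x, f x ^ 2 ∂(nu w) :=
    integral_mono (hw.integrable_sq htrunc.continuous htruncc)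
      (hw.integrable_sq hf.continuous hfc) fun x => truncation_sq_le _
  have hmass_nonneg : 0 ≤ ∫ x, truncation (f x) ^ 2 ∂(nu w) := integral_nonneg fun x => sq_nonneg _
  rw [entropy] at hlsi
  set m := ∫ x, truncation (f x) ^ 2 ∂(nu w)
  set M := ∫ x, f x ^ 2 ∂(nu w)
  have hlog : m * Real.log m ≤ M ^ 2 := calc
    _ ≤ m * m := by gcongr; exact Real.log_le_self hmass_nonneg
    _ ≤ M ^ 2 := by rw [sq]; gcongr
  have hlinear : (Real.log (normConst w) - (n + α)) * m ≤
      |Real.log (normConst w) - (n + α)| * M := by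
    gcongr
    exact le_abs_self _
  linarith

end IsHomogeneousLogConcave

section Limits

variable {X : Type*} [MeasurableSpace X] {ν : Measure X}

lemma lintegral_le_of_tendsto_ae {F : ℕ → X → ℝ≥0∞} {G : X → ℝ≥0∞} {c : ℕ → ℝ≥0∞} {C : ℝ≥0∞}
    (hF : ∀ k, AEMeasurable (F k) ν) (hG : ∀ᵐ x ∂ν, Tendsto (fun k => F k x) atTop (𝓝 (G x)))
    (hc : ∀ k, ∫⁻ x, F k x ∂ν ≤ c k) (hC : Tendsto c atTop (𝓝 C)) : ∫⁻ x, G x ∂ν ≤ C :=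
  calc ∫⁻ x, G x ∂ν = ∫⁻ x, liminf (fun k => F k x) atTop ∂ν :=
        lintegral_congr_ae (hG.mono fun x hx => hx.liminf_eq.symm)
    _ ≤ liminf (fun k => ∫⁻ x, F k x ∂ν) atTop := lintegral_liminf_le' hF
    _ ≤ liminf c atTop := liminf_le_liminf (Eventually.of_forall hc)
    _ = C := hC.liminf_eq

lemma integral_le_of_tendsto_ae_of_le {F : ℕ → X → ℝ} {G b : X → ℝ} {c : ℕ → ℝ} {C : ℝ}
    (hF : ∀ k, Integrable (F k) ν) (hb : Integrable b ν) (hbF : ∀ k, b ≤ᵐ[ν] F k)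
    (hG : ∀ᵐ x ∂ν, Tendsto (fun k => F k x) atTop (𝓝 (G x)))
    (hc : ∀ k, ∫ x, F k x ∂ν ≤ c k) (hC : Tendsto c atTop (𝓝 C)) : ∫ x, G x ∂ν ≤ C := by
  have hFb_nonneg (k : ℕ) : 0 ≤ᵐ[ν] fun x => F k x - b x := (hbF k).mono fun x => sub_nonneg.2
  have hGb_nonneg : 0 ≤ᵐ[ν] fun x => G x - b x := by
    filter_upwards [hG, ae_all_iff.2 hbF] with x hx hbx
    exact sub_nonneg.2 (ge_of_tendsto' hx hbx)
  have hFb (k : ℕ) : Integrable (fun x => F k x - b x) ν := (hF k).sub hb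
  have hFb_le (k : ℕ) : ∫ x, (F k x - b x) ∂ν ≤ c k - ∫ x, b x ∂ν := by
    rw [integral_sub (hF k) hb]
    exact sub_le_sub_right (hc k) _
  have hlim : Tendsto (fun k => c k - ∫ x, b x ∂ν) atTop (𝓝 (C - ∫ x, b x ∂ν)) := hC.sub_const _
  have hfatou : ∫⁻ x, ENNReal.ofReal (G x - b x) ∂ν ≤ ENNReal.ofReal (C - ∫ x, b x ∂ν) := by
    refine lintegral_le_of_tendsto_ae (F := fun k x => ENNReal.ofReal (F k x - b x))
      (fun k => (hFb k).aemeasurable.ennreal_ofReal)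
      (hG.mono fun x hx => ENNReal.tendsto_ofReal (hx.sub_const _)) (fun k => ?_)
      (ENNReal.tendsto_ofReal hlim)
    rw [← ofReal_integral_eq_lintegral_ofReal (hFb k) (hFb_nonneg k)]
    exact ENNReal.ofReal_le_ofReal (hFb_le k)
  have hGm : AEStronglyMeasurable (fun x => G x - b x) ν :=
    (aestronglyMeasurable_of_tendsto_ae atTop (fun k => (hF k).1) hG).sub hb.1
  have hGb : Integrable (fun x => G x - b x) ν :=
    ⟨hGm, (hasFiniteIntegral_iff_ofReal hGb_nonneg).2 (hfatou.trans_lt ENNReal.ofReal_lt_top)⟩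
  rw [← ofReal_integral_eq_lintegral_ofReal hGb hGb_nonneg, ENNReal.ofReal_le_ofReal_iff
    (ge_of_tendsto' hlim fun k => (integral_nonneg_of_ae (hFb_nonneg k)).trans (hFb_le k))]
    at hfatou
  have hsplit : ∫ x, G x ∂ν = ∫ x, (G x - b x) ∂ν + ∫ x, b x ∂ν := by
    simp only [← integral_add hGb hb, sub_add_cancel]
  linarith

variable {F : Type*} [NormedAddCommGroup F]

lemma eLpNorm_two_eq_ofReal_sqrt {φ : X → F} (hφ : MemLp φ 2 ν) :
    eLpNorm φ 2 ν = ENNReal.ofReal (√(∫ x, ‖φ x‖ ^ 2 ∂ν)) := by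
  rw [hφ.eLpNorm_eq_integral_rpow_norm (by simp) (by simp), Real.sqrt_eq_rpow]
  simp

lemma norm_toLp_two_sq {φ : X → F} (hφ : MemLp φ 2 ν) :
    ‖hφ.toLp φ‖ ^ 2 = ∫ x, ‖φ x‖ ^ 2 ∂ν := by
  rw [Lp.norm_toLp, eLpNorm_two_eq_ofReal_sqrt hφ, ENNReal.toReal_ofReal (Real.sqrt_nonneg _),
    Real.sq_sqrt (integral_nonneg fun x => sq_nonneg _)]

lemma tendsto_integral_norm_sq_of_tendsto_eLpNorm {v : ℕ → X → F} {f : X → F}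
    (hv : ∀ k, MemLp (v k) 2 ν) (hf : MemLp f 2 ν)
    (hlim : Tendsto (fun k => eLpNorm (fun x => v k x - f x) 2 ν) atTop (𝓝 0)) :
    Tendsto (fun k => ∫ x, ‖v k x‖ ^ 2 ∂ν) atTop (𝓝 (∫ x, ‖f x‖ ^ 2 ∂ν)) := by
  simp only [← norm_toLp_two_sq hf, ← norm_toLp_two_sq (hv _)]
  exact ((Lp.tendsto_Lp_iff_tendsto_eLpNorm'' v hv f hf).2 hlim).norm.pow 2

lemma tendsto_eLpNorm_two_of_dominated {h : ℕ → X → F} {b : X → ℝ} (hb : MemLp b 2 ν)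
    (hm : ∀ k, AEStronglyMeasurable (h k) ν) (hle : ∀ k, ∀ᵐ x ∂ν, ‖h k x‖ ≤ b x)
    (hlim : ∀ᵐ x ∂ν, Tendsto (fun k => h k x) atTop (𝓝 0)) :
    Tendsto (fun k => eLpNorm (h k) 2 ν) atTop (𝓝 0) := by
  have hmem (k : ℕ) : MemLp (h k) 2 ν :=
    hb.of_le (hm k) ((hle k).mono fun x hx => hx.trans (le_abs_self _))
  have hint : Tendsto (fun k => ∫ x, ‖h k x‖ ^ 2 ∂ν) atTop (𝓝 (∫ _, 0 ∂ν)) := by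
    refine tendsto_integral_of_dominated_convergence (fun x => b x ^ 2)
      (fun k => (hm k).norm.pow 2) hb.integrable_sq (fun k => (hle k).mono fun x hx => ?_)
      (hlim.mono fun x hx => by simpa using hx.norm.pow 2)
    rw [Real.norm_of_nonneg (sq_nonneg _)]
    gcongr
  simp only [eLpNorm_two_eq_ofReal_sqrt (hmem _)]
  simpa using ENNReal.tendsto_ofReal hint.sqrt

end Limits

section Cutoff

variable {E : Type*} [NormedAddCommGroup E] [InnerProductSpace ℝ E]

/-- A smooth radial cutoff, equal to `1` on the ball of radius `R` and supported in the ball of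
radius `2 R`. -/
def cutoff (R : ℝ) (x : E) : ℝ := Real.smoothTransition (2 - ‖R⁻¹ • x‖ ^ 2)

lemma contDiff_cutoff (R : ℝ) : ContDiff ℝ ∞ (cutoff R : E → ℝ) :=
  Real.smoothTransition.contDiff.comp
    (contDiff_const.sub ((contDiff_norm_sq ℝ).comp (contDiff_const_smul _)))

lemma cutoff_nonneg (R : ℝ) (x : E) : 0 ≤ cutoff R x := Real.smoothTransition.nonneg _

lemma cutoff_le_one (R : ℝ) (x : E) : cutoff R x ≤ 1 := Real.smoothTransition.le_one _

lemma norm_cutoff_smul_le {F : Type*} [NormedAddCommGroup F] [NormedSpace ℝ F] (R : ℝ) (x : E)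
    (y : F) : ‖cutoff R x • y‖ ≤ ‖y‖ := by
  rw [norm_smul, Real.norm_of_nonneg (cutoff_nonneg R x)]
  exact mul_le_of_le_one_left (norm_nonneg _) (cutoff_le_one R x)

lemma cutoff_eq_one {R : ℝ} (hR : 0 < R) {x : E} (hx : ‖x‖ ≤ R) : cutoff R x = 1 := by
  refine Real.smoothTransition.one_of_one_le ?_
  have hle : ‖R⁻¹ • x‖ ≤ 1 := by
    rwa [norm_smul, Real.norm_of_nonneg (by positivity), inv_mul_le_one₀ hR]
  linarith [pow_le_one₀ (n := 2) (norm_nonneg _) hle]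

lemma eventually_cutoff_eq_one (x : E) : ∀ᶠ k : ℕ in atTop, cutoff (k + 1 : ℝ) x = 1 := by
  filter_upwards [eventually_ge_atTop ⌈‖x‖⌉₊] with k hk
  refine cutoff_eq_one (by positivity) ?_
  linarith [Nat.ceil_le.1 hk]

lemma tendsto_cutoff (x : E) : Tendsto (fun k : ℕ => cutoff (k + 1 : ℝ) x) atTop (𝓝 1) :=
  tendsto_const_nhds.congr' ((eventually_cutoff_eq_one x).mono fun _ => Eq.symm)

lemma cutoff_eq_zero {R : ℝ} (hR : 0 < R) {x : E} (hx : x ∉ Metric.closedBall 0 (2 * R)) :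
    cutoff R x = 0 := by
  refine Real.smoothTransition.zero_of_nonpos ?_
  rw [mem_closedBall_zero_iff, not_le] at hx
  have hge : 2 ≤ ‖R⁻¹ • x‖ := by
    rw [norm_smul, Real.norm_of_nonneg (by positivity), le_inv_mul_iff₀ hR]
    linarith
  nlinarith

section MemLp

variable [MeasurableSpace E] [OpensMeasurableSpace E] {ν : Measure E} {f : E → ℝ}

lemma memLp_cutoff_mul (hf : MemLp f 2 ν) (R : ℝ) : MemLp (fun x => cutoff R x * f x) 2 ν :=
  hf.of_le ((contDiff_cutoff R).continuous.aestronglyMeasurable.mul hf.1)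
    (ae_of_all _ fun x => norm_cutoff_smul_le R x (f x))

lemma tendsto_eLpNorm_cutoff_mul_sub (hf : MemLp f 2 ν) :
    Tendsto (fun k : ℕ => eLpNorm (fun x => cutoff (k + 1 : ℝ) x * f x - f x) 2 ν) atTop
      (𝓝 0) := by
  refine tendsto_eLpNorm_two_of_dominated (hf.norm.add hf.norm)
    (fun k => (memLp_cutoff_mul hf _).1.sub hf.1) (fun k => ae_of_all _ fun x => ?_)
    (ae_of_all _ fun x => ?_)
  · exact (norm_sub_le _ _).trans (add_le_add (norm_cutoff_smul_le _ x (f x)) le_rfl)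
  · simpa using ((tendsto_cutoff x).mul_const (f x)).sub_const (f x)

lemma tendsto_integral_cutoff_mul_sq (hf : MemLp f 2 ν) :
    Tendsto (fun k : ℕ => ∫ x, (cutoff (k + 1 : ℝ) x * f x) ^ 2 ∂ν) atTop
      (𝓝 (∫ x, f x ^ 2 ∂ν)) := by
  simpa only [Real.norm_eq_abs, sq_abs] using tendsto_integral_norm_sq_of_tendsto_eLpNorm
    (fun k => memLp_cutoff_mul hf _) hf (tendsto_eLpNorm_cutoff_mul_sub hf)

end MemLp

variable [CompleteSpace E]

lemma gradient_cutoff_eq_zero {R : ℝ} (hR : 0 < R) {x : E}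
    (hx : x ∉ Metric.closedBall 0 (2 * R)) : gradient (cutoff R) x = 0 := by
  have hlocal : (cutoff R : E → ℝ) =ᶠ[𝓝 x] fun _ => 0 := by
    filter_upwards [Metric.isClosed_closedBall.isOpen_compl.mem_nhds hx] with y hy
    exact cutoff_eq_zero hR hy
  simp [gradient, hlocal.fderiv_eq]

lemma continuous_gradient_cutoff (R : ℝ) :
    Continuous (gradient (cutoff R : E → ℝ)) :=
  continuous_gradient (contDiff_infty.1 (contDiff_cutoff R) 1)

/-- The gradient of `cutoff R * f` when `f` has gradient `g`. The vector field `g` is arbitrary, so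
that the definition applies to Sobolev functions, for which `gradient f` is meaningless. -/
def cutoffGradient (R : ℝ) (f : E → ℝ) (g : E → E) (x : E) : E :=
  cutoff R x • g x + f x • gradient (cutoff R) x

lemma gradient_cutoff_mul (R : ℝ) {f : E → ℝ} (hf : Differentiable ℝ f) :
    gradient (fun x => cutoff R x * f x) = cutoffGradient R f (gradient f) :=
  funext fun x => (hasGradientAt_mul
    ((contDiff_cutoff R).differentiable (by simp) x).hasGradientAt (hf x).hasGradientAt).gradient

lemma cutoffGradient_sub (R : ℝ) (f₁ f₂ : E → ℝ) (g₁ g₂ : E → E) (x : E) :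
    cutoffGradient R f₁ g₁ x - cutoffGradient R f₂ g₂ x =
      cutoffGradient R (fun x => f₁ x - f₂ x) (fun x => g₁ x - g₂ x) x := by
  simp only [cutoffGradient]
  module

lemma norm_cutoffGradient_le {R K : ℝ} {f : E → ℝ} {g : E → E} {x : E}
    (hK : ‖gradient (cutoff R) x‖ ≤ K) : ‖cutoffGradient R f g x‖ ≤ ‖g x‖ + K * ‖f x‖ := by
  refine (norm_add_le _ _).trans (add_le_add (norm_cutoff_smul_le R x _) ?_)
  rw [norm_smul, mul_comm]
  gcongr

end Cutoff

section CutoffConvergence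

variable {E : Type*} [NormedAddCommGroup E] [InnerProductSpace ℝ E] [ProperSpace E]

lemma hasCompactSupport_cutoff {R : ℝ} (hR : 0 < R) : HasCompactSupport (cutoff R : E → ℝ) :=
  HasCompactSupport.intro (isCompact_closedBall _ _) fun _ hx => cutoff_eq_zero hR hx

variable (E) in
lemma exists_norm_gradient_cutoff_le :
    ∃ K, 0 ≤ K ∧ ∀ R, 0 < R → ∀ x : E, ‖gradient (cutoff R) x‖ ≤ K / R := by
  have hcompact : HasCompactSupport (gradient (cutoff 1 : E → ℝ)) :=
    hasCompactSupport_gradient (hasCompactSupport_cutoff one_pos)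
  obtain ⟨K, hK⟩ := hcompact.exists_bound_of_continuous (continuous_gradient_cutoff 1)
  refine ⟨K, (norm_nonneg _).trans (hK 0), fun R hR x => ?_⟩
  have hscale : (cutoff R : E → ℝ) = fun x => cutoff 1 (R⁻¹ • x) := by
    ext x
    simp [cutoff]
  have hgrad := (hasGradientAt_comp_smul (t := R⁻¹) (x := x)
    ((contDiff_cutoff 1).differentiable (by simp) (R⁻¹ • x))).gradient
  rw [hscale, hgrad, norm_smul, Real.norm_of_nonneg (by positivity), div_eq_inv_mul]
  gcongr
  exact hK _

lemma tendsto_gradient_cutoff (x : E) :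
    Tendsto (fun k : ℕ => gradient (cutoff (k + 1 : ℝ)) x) atTop (𝓝 0) := by
  obtain ⟨K, -, hK⟩ := exists_norm_gradient_cutoff_le E
  refine squeeze_zero_norm (fun k => hK _ (by positivity) x) ?_
  simpa [div_eq_mul_inv] using tendsto_one_div_add_atTop_nhds_zero_nat.const_mul K

variable [MeasurableSpace E] [BorelSpace E] {ν : Measure E} {f : E → ℝ} {g : E → E}

lemma aestronglyMeasurable_cutoffGradient (hf : AEStronglyMeasurable f ν)
    (hg : AEStronglyMeasurable g ν) (R : ℝ) : AEStronglyMeasurable (cutoffGradient R f g) ν :=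
  ((contDiff_cutoff R).continuous.aestronglyMeasurable.smul hg).add
    (hf.smul (continuous_gradient_cutoff R).aestronglyMeasurable)

lemma eLpNorm_cutoffGradient_le (hf : AEStronglyMeasurable f ν) (hg : AEStronglyMeasurable g ν)
    {R K : ℝ} (hK : ∀ x : E, ‖gradient (cutoff R) x‖ ≤ K) :
    eLpNorm (cutoffGradient R f g) 2 ν ≤ eLpNorm g 2 ν + ENNReal.ofReal K * eLpNorm f 2 ν := by
  refine (eLpNorm_add_le ((contDiff_cutoff R).continuous.aestronglyMeasurable.smul hg)
    (hf.smul (continuous_gradient_cutoff R).aestronglyMeasurable) (by norm_num)).trans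
    (add_le_add (eLpNorm_mono fun x => norm_cutoff_smul_le R x (g x))
      (eLpNorm_le_mul_eLpNorm_of_ae_le_mul (ae_of_all _ fun x => ?_) 2))
  rw [Pi.smul_apply', norm_smul, mul_comm]
  gcongr
  exact hK x

lemma memLp_cutoffGradient (hf : MemLp f 2 ν) (hg : MemLp g 2 ν) {R : ℝ} (hR : 0 < R) :
    MemLp (cutoffGradient R f g) 2 ν := by
  obtain ⟨K, -, hK⟩ := exists_norm_gradient_cutoff_le E
  exact (hg.norm.add (hf.norm.const_mul (K / R))).of_le
    (aestronglyMeasurable_cutoffGradient hf.1 hg.1 R)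
    (ae_of_all _ fun x => (norm_cutoffGradient_le (hK R hR x)).trans (le_abs_self _))

lemma tendsto_eLpNorm_cutoffGradient_sub (hf : MemLp f 2 ν) (hg : MemLp g 2 ν) :
    Tendsto (fun k : ℕ => eLpNorm (fun x => cutoffGradient (k + 1 : ℝ) f g x - g x) 2 ν) atTop
      (𝓝 0) := by
  obtain ⟨K, hK_nonneg, hK⟩ := exists_norm_gradient_cutoff_le E
  have hbound (k : ℕ) (x : E) : ‖gradient (cutoff (k + 1 : ℝ)) x‖ ≤ K :=
    (hK _ (by positivity) x).trans (div_le_self hK_nonneg (by simp))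
  refine tendsto_eLpNorm_two_of_dominated ((hg.norm.add (hf.norm.const_mul K)).add hg.norm)
    (fun k => (aestronglyMeasurable_cutoffGradient hf.1 hg.1 _).sub hg.1)
    (fun k => ae_of_all _ fun x => ?_) (ae_of_all _ fun x => ?_)
  · exact (norm_sub_le _ _).trans (add_le_add (norm_cutoffGradient_le (hbound k x)) le_rfl)
  · simpa [cutoffGradient] using (((tendsto_cutoff x).smul_const (g x)).add
      ((tendsto_gradient_cutoff x).const_smul (f x))).sub_const (g x)

lemma tendsto_integral_norm_cutoffGradient_sq (hf : MemLp f 2 ν) (hg : MemLp g 2 ν) :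
    Tendsto (fun k : ℕ => ∫ x, ‖cutoffGradient (k + 1 : ℝ) f g x‖ ^ 2 ∂ν) atTop
      (𝓝 (∫ x, ‖g x‖ ^ 2 ∂ν)) :=
  tendsto_integral_norm_sq_of_tendsto_eLpNorm
    (fun k => memLp_cutoffGradient hf hg (by positivity)) hg
    (tendsto_eLpNorm_cutoffGradient_sub hf hg)

end CutoffConvergence

lemma aestronglyMeasurable_sq_mul_log_sq {X : Type*} [MeasurableSpace X] {ν : Measure X}
    {φ : X → ℝ} (hφ : AEStronglyMeasurable φ ν) :
    AEStronglyMeasurable (fun x => φ x ^ 2 * Real.log (φ x ^ 2)) ν :=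
  Real.continuous_mul_log.comp_aestronglyMeasurable (hφ.pow 2)

lemma tendsto_sq_mul_log_sq {ι : Type*} {l : Filter ι} {v : ι → ℝ} {r : ℝ}
    (hv : Tendsto v l (𝓝 r)) :
    Tendsto (fun k => v k ^ 2 * Real.log (v k ^ 2)) l (𝓝 (r ^ 2 * Real.log (r ^ 2))) :=
  (Real.continuous_mul_log.tendsto _).comp (hv.pow 2)

lemma abs_mul_log_mul_le {c y : ℝ} (hc : 0 ≤ c) (hc' : c ≤ 1) (hy : 0 ≤ y) :
    |c * y * Real.log (c * y)| ≤ |y * Real.log y| + y := by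
  have hsplit : c * y * Real.log (c * y) = c * (y * Real.log y) + y * (c * Real.log c) := by
    rcases eq_or_ne c 0 with rfl | hc_ne
    · simp
    rcases eq_or_ne y 0 with rfl | hy_ne
    · simp
    rw [Real.log_mul hc_ne hy_ne]
    ring
  have hclog : |c * Real.log c| ≤ 1 := by
    rw [abs_le]
    constructor <;> linarith [Real.self_sub_one_le_mul_log hc,
      mul_nonpos_of_nonneg_of_nonpos hc (Real.log_nonpos hc hc')]
  calc |c * y * Real.log (c * y)| ≤ c * |y * Real.log y| + y * |c * Real.log c| := by
        rw [hsplit]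
        refine (abs_add_le _ _).trans_eq ?_
        rw [abs_mul c (y * _), abs_mul y (c * _), abs_of_nonneg hc, abs_of_nonneg hy]
    _ ≤ |y * Real.log y| + y := add_le_add (mul_le_of_le_one_left (abs_nonneg _) hc')
        (mul_le_of_le_one_right hy hclog)

lemma tendsto_integral_cutoff_mul_sq_mul_log {E : Type*} [NormedAddCommGroup E]
    [InnerProductSpace ℝ E] [MeasurableSpace E] [OpensMeasurableSpace E] {ν : Measure E} {f : E → ℝ}
    (hf : MemLp f 2 ν) (hint : Integrable (fun x => f x ^ 2 * Real.log (f x ^ 2)) ν) :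
    Tendsto (fun k : ℕ => ∫ x, (cutoff (k + 1 : ℝ) x * f x) ^ 2 *
      Real.log ((cutoff (k + 1 : ℝ) x * f x) ^ 2) ∂ν) atTop
      (𝓝 (∫ x, f x ^ 2 * Real.log (f x ^ 2) ∂ν)) := by
  refine tendsto_integral_of_dominated_convergence
    (fun x => |f x ^ 2 * Real.log (f x ^ 2)| + f x ^ 2)
    (fun k => aestronglyMeasurable_sq_mul_log_sq (memLp_cutoff_mul hf _).1)
    (hint.abs.add hf.integrable_sq) (fun k => ae_of_all _ fun x => ?_) (ae_of_all _ fun x => ?_)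
  · rw [Real.norm_eq_abs, mul_pow]
    exact abs_mul_log_mul_le (sq_nonneg _) (pow_le_one₀ (cutoff_nonneg _ x) (cutoff_le_one _ x))
      (sq_nonneg _)
  · simpa using tendsto_sq_mul_log_sq ((tendsto_cutoff x).mul_const (f x))

namespace IsHomogeneousLogConcave

variable {n : ℕ} {α : ℝ} {w : (𝔼 n) → ℝ} {f : (𝔼 n) → ℝ} {g : (𝔼 n) → 𝔼 n} {R t : ℝ}

lemma nu_restrict_closedBall_le (hw : IsHomogeneousLogConcave α w) (R : ℝ) :
    (nu w).restrict (Metric.closedBall 0 R) ≤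
      ENNReal.ofReal ((normConst w)⁻¹ * Real.exp (R ^ 2 / 2)) • mu w := by
  have hball : MeasurableSet (Metric.closedBall (0 : 𝔼 n) R) := measurableSet_closedBall
  rw [hw.mu_eq_withDensity_nu, ← withDensity_smul _ (by fun_prop),
    ← withDensity_indicator_one hball]
  refine withDensity_mono (ae_of_all _ (Set.indicator_le fun x hx => ?_))
  have hprod : (normConst w)⁻¹ * Real.exp (R ^ 2 / 2) * (normConst w * Real.exp (-‖x‖ ^ 2 / 2))
      = Real.exp ((R ^ 2 - ‖x‖ ^ 2) / 2) := by
    rw [mul_mul_mul_comm, inv_mul_cancel₀ hw.normConst_pos.ne', one_mul, ← Real.exp_add]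
    ring_nf
  have hC := hw.normConst_pos
  rw [Pi.smul_apply, smul_eq_mul, ← ENNReal.ofReal_mul (by positivity), Pi.one_apply,
    ENNReal.one_le_ofReal, hprod, Real.one_le_exp_iff]
  have hnorm : ‖x‖ ^ 2 ≤ R ^ 2 := by
    gcongr
    exact mem_closedBall_zero_iff.1 hx
  linarith

lemma tendsto_eLpNorm_nu_of_tendsto_eLpNorm_mu (hw : IsHomogeneousLogConcave α w) {F : Type*}
    [NormedAddCommGroup F] {φ : ℕ → (𝔼 n) → F}
    (hφ : ∀ k, ∀ x ∉ Metric.closedBall 0 R, φ k x = 0)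
    (hlim : Tendsto (fun k => eLpNorm (φ k) 2 (mu w)) atTop (𝓝 0)) :
    Tendsto (fun k => eLpNorm (φ k) 2 (nu w)) atTop (𝓝 0) := by
  set c := ENNReal.ofReal ((normConst w)⁻¹ * Real.exp (R ^ 2 / 2)) ^ (1 / (2 : ℝ≥0∞)).toReal
  have hle (k : ℕ) : eLpNorm (φ k) 2 (nu w) ≤ c * eLpNorm (φ k) 2 (mu w) := by
    rw [← eLpNorm_restrict_eq_of_support_subset (s := Metric.closedBall 0 R)
      (fun x hx => by_contra fun hx' => hx (hφ k x hx'))]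
    refine (eLpNorm_mono_measure _ (hw.nu_restrict_closedBall_le R)).trans_eq ?_
    rw [eLpNorm_smul_measure_of_ne_top (by simp), smul_eq_mul]
  refine tendsto_of_tendsto_of_tendsto_of_le_of_le tendsto_const_nhds ?_ (fun _ => zero_le) hle
  simpa using ENNReal.Tendsto.const_mul hlim (Or.inr (by simp [c]))

lemma tendsto_eLpNorm_nu_cutoff_mul_sub (hw : IsHomogeneousLogConcave α w) (hR : 0 < R)
    {u : ℕ → (𝔼 n) → ℝ}
    (hu : Tendsto (fun k => eLpNorm (fun x => u k x - f x) 2 (mu w)) atTop (𝓝 0)) :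
    Tendsto (fun k => eLpNorm (fun x => cutoff R x * u k x - cutoff R x * f x) 2 (nu w)) atTop
      (𝓝 0) := by
  refine hw.tendsto_eLpNorm_nu_of_tendsto_eLpNorm_mu (R := 2 * R)
    (fun k x hx => by simp [cutoff_eq_zero hR hx])
    (tendsto_of_tendsto_of_tendsto_of_le_of_le tendsto_const_nhds hu (fun _ => zero_le)
      fun k => eLpNorm_mono fun x => ?_)
  rw [← mul_sub]
  exact norm_cutoff_smul_le R x (u k x - f x)

lemma tendsto_eLpNorm_nu_cutoffGradient_sub (hw : IsHomogeneousLogConcave α w) (hR : 0 < R)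
    {u : ℕ → (𝔼 n) → ℝ} {γ : ℕ → (𝔼 n) → 𝔼 n}
    (hum : ∀ k, AEStronglyMeasurable (fun x => u k x - f x) (mu w))
    (hγm : ∀ k, AEStronglyMeasurable (fun x => γ k x - g x) (mu w))
    (hu : Tendsto (fun k => eLpNorm (fun x => u k x - f x) 2 (mu w)) atTop (𝓝 0))
    (hγ : Tendsto (fun k => eLpNorm (fun x => γ k x - g x) 2 (mu w)) atTop (𝓝 0)) :
    Tendsto (fun k => eLpNorm (fun x => cutoffGradient R (u k) (γ k) x - cutoffGradient R f g x)
      2 (nu w)) atTop (𝓝 0) := by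
  obtain ⟨K, -, hK⟩ := exists_norm_gradient_cutoff_le (𝔼 n)
  simp_rw [cutoffGradient_sub]
  refine hw.tendsto_eLpNorm_nu_of_tendsto_eLpNorm_mu (R := 2 * R) (fun k x hx => by
    simp [cutoffGradient, cutoff_eq_zero hR hx, gradient_cutoff_eq_zero hR hx]) ?_
  refine tendsto_of_tendsto_of_tendsto_of_le_of_le tendsto_const_nhds ?_ (fun _ => zero_le)
    fun k => eLpNorm_cutoffGradient_le (hum k) (hγm k) (hK R hR)
  simpa using hγ.add (ENNReal.Tendsto.const_mul hu (Or.inr ENNReal.ofReal_ne_top))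

lemma memLp_nu_of_hasCompactSupport (hw : IsHomogeneousLogConcave α w) {F : Type*}
    [NormedAddCommGroup F] {φ : (𝔼 n) → F} (hφ : Continuous φ) (hφc : HasCompactSupport φ) :
    MemLp φ 2 (nu w) :=
  have := hw.isLocallyFiniteMeasure_nu
  hφ.memLp_of_hasCompactSupport hφc

lemma exists_approx_cutoff_mul (hw : IsHomogeneousLogConcave α w) (hfg : Admissible w f g)
    (hR : 0 < R) :
    ∃ v : ℕ → (𝔼 n) → ℝ, (∀ k, ContDiff ℝ 2 (v k)) ∧ (∀ k, HasCompactSupport (v k)) ∧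
      (∀ k, ∀ x ∉ Metric.closedBall 0 (2 * R), v k x = 0) ∧
      (∀ᵐ x ∂(nu w), Tendsto (fun k => v k x) atTop (𝓝 (cutoff R x * f x))) ∧
      Tendsto (fun k => ∫ x, v k x ^ 2 ∂(nu w)) atTop
        (𝓝 (∫ x, (cutoff R x * f x) ^ 2 ∂(nu w))) ∧
      Tendsto (fun k => ∫ x, ‖gradient (v k) x‖ ^ 2 ∂(nu w)) atTop
        (𝓝 (∫ x, ‖cutoffGradient R f g x‖ ^ 2 ∂(nu w))) := by
  obtain ⟨⟨hfμ, hgμ, u, hu, hlim⟩, hfν, hgν⟩ := hfg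
  obtain ⟨hulim, hglim⟩ : Tendsto (fun k => eLpNorm (fun x => u k x - f x) 2 (mu w)) atTop (𝓝 0) ∧
      Tendsto (fun k => eLpNorm (fun x => gradient (u k) x - g x) 2 (mu w)) atTop (𝓝 0) :=
    ⟨tendsto_of_tendsto_of_tendsto_of_le_of_le tendsto_const_nhds hlim (fun _ => zero_le)
      fun _ => le_self_add, tendsto_of_tendsto_of_tendsto_of_le_of_le tendsto_const_nhds hlim
      (fun _ => zero_le) fun _ => le_add_self⟩
  set v : ℕ → (𝔼 n) → ℝ := fun k x => cutoff R x * u k x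
  have hv (k : ℕ) : ContDiff ℝ 2 (v k) := contDiff_infty.1 ((contDiff_cutoff R).mul (hu k).1) 2
  have hvc (k : ℕ) : HasCompactSupport (v k) := (hu k).2.1.mul_left
  have hgrad (k : ℕ) : gradient (v k) = cutoffGradient R (u k) (gradient (u k)) :=
    gradient_cutoff_mul R ((hu k).1.differentiable (by simp))
  have hvm (k : ℕ) : MemLp (v k) 2 (nu w) :=
    hw.memLp_nu_of_hasCompactSupport (hv k).continuous (hvc k)
  have hvgm (k : ℕ) : MemLp (gradient (v k)) 2 (nu w) :=
    hw.memLp_nu_of_hasCompactSupport (continuous_gradient ((hv k).of_le (by norm_num)))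
      (hasCompactSupport_gradient (hvc k))
  have hvlim := hw.tendsto_eLpNorm_nu_cutoff_mul_sub hR hulim
  have hvglim := hw.tendsto_eLpNorm_nu_cutoffGradient_sub hR
    (fun k => (hu k).1.continuous.aestronglyMeasurable.sub hfμ.1)
    (fun k => (continuous_gradient (contDiff_infty.1 (hu k).1 1)).aestronglyMeasurable.sub hgμ.1)
    hulim hglim
  simp only [← hgrad] at hvglim
  have hmass := tendsto_integral_norm_sq_of_tendsto_eLpNorm hvm (memLp_cutoff_mul hfν R) hvlim
  simp only [Real.norm_eq_abs, sq_abs] at hmass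
  have henergy := tendsto_integral_norm_sq_of_tendsto_eLpNorm hvgm
    (memLp_cutoffGradient hfν hgν hR) hvglim
  obtain ⟨ns, hns, hae⟩ := (tendstoInMeasure_of_tendsto_eLpNorm (by norm_num)
    (fun k => (hvm k).1) (memLp_cutoff_mul hfν R).1 hvlim).exists_seq_tendsto_ae
  exact ⟨fun k => v (ns k), fun k => hv _, fun k => hvc _,
    fun k x hx => by simp [v, cutoff_eq_zero hR hx], hae, hmass.comp hns.tendsto_atTop,
    henergy.comp hns.tendsto_atTop⟩

lemma entropy_nu_cutoff_mul_sq_le (hw : IsHomogeneousLogConcave α w) (hfg : Admissible w f g)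
    (hR : 0 < R) (ht : 0 < t) :
    entropy (nu w) (fun x => (cutoff R x * f x) ^ 2) ≤
      (Real.log (normConst w) - (n + α) - (n + α) * Real.log t) *
        (∫ x, (cutoff R x * f x) ^ 2 ∂(nu w))
        + 2 * t ^ 2 * ∫ x, ‖cutoffGradient R f g x‖ ^ 2 ∂(nu w) := by
  obtain ⟨v, hv, hvc, hv_zero, hae, hmass, henergy⟩ := hw.exists_approx_cutoff_mul hfg hR
  have := hw.isLocallyFiniteMeasure_nu
  set B := Metric.closedBall (0 : 𝔼 n) (2 * R)
  have hB : Integrable (B.indicator fun _ => (-1 : ℝ)) (nu w) :=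
    (integrable_indicator_iff measurableSet_closedBall).2
      (integrableOn_const (isCompact_closedBall _ _).measure_lt_top.ne)
  have hlower (k : ℕ) (x : 𝔼 n) :
      B.indicator (fun _ => (-1 : ℝ)) x ≤ v k x ^ 2 * Real.log (v k x ^ 2) := by
    by_cases hx : x ∈ B
    · rw [Set.indicator_of_mem hx]
      linarith [Real.self_sub_one_le_mul_log (sq_nonneg (v k x)), sq_nonneg (v k x)]
    · simp [hv_zero k x hx, hx]
  have hfatou := integral_le_of_tendsto_ae_of_le
    (fun k => hw.integrable_sq_mul_log_sq (hv k).continuous (hvc k)) hB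
    (fun k => ae_of_all _ (hlower k)) (hae.mono fun x hx => tendsto_sq_mul_log_sq hx)
    (fun k => sub_le_iff_le_add.1 (hw.entropy_nu_sq_le_of_pos (hv k) (hvc k) ht))
    (((hmass.const_mul _).add (henergy.const_mul _)).add
      ((Real.continuous_mul_log.tendsto _).comp hmass))
  exact sub_le_iff_le_add.2 hfatou

lemma entPos_nu_cutoff_mul_sq_le (hw : IsHomogeneousLogConcave α w) {a b : ℝ}
    (hab : ∀ f : (𝔼 n) → ℝ, ContDiff ℝ 2 f → HasCompactSupport f →
      entPos (nu w) (fun x => f x ^ 2) ≤ ENNReal.ofReal ((∫ x, f x ^ 2 ∂(nu w)) ^ 2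
        + a * (∫ x, f x ^ 2 ∂(nu w)) + b * ∫ x, ‖gradient f x‖ ^ 2 ∂(nu w)))
    (hfg : Admissible w f g) (hR : 0 < R) :
    entPos (nu w) (fun x => (cutoff R x * f x) ^ 2) ≤ ENNReal.ofReal
      ((∫ x, (cutoff R x * f x) ^ 2 ∂(nu w)) ^ 2 + a * (∫ x, (cutoff R x * f x) ^ 2 ∂(nu w))
        + b * ∫ x, ‖cutoffGradient R f g x‖ ^ 2 ∂(nu w)) := by
  obtain ⟨v, hv, hvc, -, hae, hmass, henergy⟩ := hw.exists_approx_cutoff_mul hfg hR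
  exact lintegral_le_of_tendsto_ae
    (fun k => (aestronglyMeasurable_sq_mul_log_sq
      (hv k).continuous.aestronglyMeasurable).aemeasurable.ennreal_ofReal)
    (hae.mono fun x hx => ENNReal.tendsto_ofReal (tendsto_sq_mul_log_sq hx))
    (fun k => hab (v k) (hv k) (hvc k))
    (ENNReal.tendsto_ofReal
      (((hmass.pow 2).add (hmass.const_mul a)).add (henergy.const_mul b)))

lemma entPos_nu_sq_lt_top (hw : IsHomogeneousLogConcave α w) (hfg : Admissible w f g) :
    entPos (nu w) (fun x => f x ^ 2) < ⊤ := by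
  obtain ⟨a, b, hab⟩ := hw.entPos_nu_sq_le
  have hmass := tendsto_integral_cutoff_mul_sq hfg.2.1
  have henergy := tendsto_integral_norm_cutoffGradient_sq hfg.2.1 hfg.2.2
  refine lt_of_le_of_lt (lintegral_le_of_tendsto_ae (fun k => ?_) (ae_of_all _ fun x => ?_)
    (fun k : ℕ => hw.entPos_nu_cutoff_mul_sq_le hab hfg (R := k + 1) (by positivity))
    (ENNReal.tendsto_ofReal
      (((hmass.pow 2).add (hmass.const_mul a)).add (henergy.const_mul b))))
    ENNReal.ofReal_lt_top
  · exact (aestronglyMeasurable_sq_mul_log_sq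
      (memLp_cutoff_mul hfg.2.1 _).1).aemeasurable.ennreal_ofReal
  · simpa using ENNReal.tendsto_ofReal
      (tendsto_sq_mul_log_sq ((tendsto_cutoff x).mul_const (f x)))

lemma integrable_sq_mul_log_sq_of_entNeg_ne_top (hw : IsHomogeneousLogConcave α w)
    (hfg : Admissible w f g) (hneg : entNeg (nu w) (fun x => f x ^ 2) ≠ ⊤) :
    Integrable (fun x => f x ^ 2 * Real.log (f x ^ 2)) (nu w) := by
  have hm := (aestronglyMeasurable_sq_mul_log_sq hfg.2.1.1).aemeasurable
  have hpos := integrable_toReal_of_lintegral_ne_top hm.ennreal_ofReal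
    (hw.entPos_nu_sq_lt_top hfg).ne
  have hneg := integrable_toReal_of_lintegral_ne_top hm.neg.ennreal_ofReal hneg
  refine (hpos.sub hneg).congr (ae_of_all _ fun x => ?_)
  simp only [Pi.sub_apply, Pi.neg_apply, ENNReal.toReal_ofReal']
  exact max_zero_sub_max_neg_zero_eq_self (f x ^ 2 * Real.log (f x ^ 2))

lemma entropy_nu_sq_le_of_admissible (hw : IsHomogeneousLogConcave α w) (hfg : Admissible w f g)
    (hint : Integrable (fun x => f x ^ 2 * Real.log (f x ^ 2)) (nu w)) (ht : 0 < t) :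
    entropy (nu w) (fun x => f x ^ 2) ≤
      (Real.log (normConst w) - (n + α) - (n + α) * Real.log t) * (∫ x, f x ^ 2 ∂(nu w))
        + 2 * t ^ 2 * ∫ x, ‖g x‖ ^ 2 ∂(nu w) := by
  have hmass := tendsto_integral_cutoff_mul_sq hfg.2.1
  have henergy := tendsto_integral_norm_cutoffGradient_sq hfg.2.1 hfg.2.2
  have hentropy := (tendsto_integral_cutoff_mul_sq_mul_log hfg.2.1 hint).sub
    ((Real.continuous_mul_log.tendsto _).comp hmass)
  exact le_of_tendsto_of_tendsto' hentropy
    ((hmass.const_mul _).add (henergy.const_mul (2 * t ^ 2)))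
    fun k => hw.entropy_nu_cutoff_mul_sq_le hfg (by positivity) ht

end IsHomogeneousLogConcave

section Optimization

variable {N m D S L : ℝ}

lemma nonpos_of_forall_le_sq (h : ∀ t : ℝ, 0 < t → S ≤ 2 * t ^ 2 * D) : S ≤ 0 := by
  have hcont : Continuous fun t : ℝ => 2 * t ^ 2 * D := by fun_prop
  have hlim : Tendsto (fun t : ℝ => 2 * t ^ 2 * D) (𝓝[>] 0) (𝓝 0) := by
    simpa using (hcont.tendsto 0).mono_left nhdsWithin_le_nhds
  exact ge_of_tendsto hlim (eventually_nhdsWithin_of_forall h)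

lemma not_forall_le_sub_log (hN : 0 < N) (hm : 0 < m) :
    ¬ ∀ t : ℝ, 0 < t → S ≤ (L - N * Real.log t) * m := by
  intro h
  have hs := h (Real.exp ((L - (S - 1) / m) / N)) (Real.exp_pos _)
  rw [Real.log_exp, mul_div_cancel₀ _ hN.ne', sub_sub_cancel, div_mul_cancel₀ _ hm.ne'] at hs
  linarith

lemma le_log_of_forall_le_of_pos (hN : 0 < N) (hm : 0 < m) (hD : 0 < D)
    (h : ∀ t : ℝ, 0 < t → S ≤ (L - N - N * Real.log t) * m + 2 * t ^ 2 * D) :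
    S ≤ N / 2 * m * Real.log (4 / N * Real.exp (2 / N * L - 1) * (D / m)) := by
  -- The right-hand side of `h` is minimal at `t = √r`.
  set r := N * m / (4 * D) with hr_def
  have hr : 0 < r := by positivity
  have hinv : 4 / N * Real.exp (2 / N * L - 1) * (D / m) = Real.exp (2 / N * L - 1) * r⁻¹ := by
    rw [hr_def]; field_simp
  rw [hinv, Real.log_mul (Real.exp_ne_zero _) (inv_ne_zero hr.ne'), Real.log_exp, Real.log_inv]
  calc S ≤ (L - N - N * (Real.log r / 2)) * m + 2 * r * D := by
        simpa only [Real.sq_sqrt hr.le, Real.log_sqrt hr.le] using h √r (Real.sqrt_pos.2 hr)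
    _ = _ := by rw [show 2 * r * D = N * m / 2 by rw [hr_def]; field_simp; ring]; field_simp; ring

lemma le_log_of_forall_le (hN : 0 < N) (hm : 0 ≤ m) (hD : 0 ≤ D)
    (h : ∀ t : ℝ, 0 < t → S ≤ (L - N - N * Real.log t) * m + 2 * t ^ 2 * D) :
    S ≤ N / 2 * m * Real.log (4 / N * Real.exp (2 / N * L - 1) * (D / m)) := by
  rcases hm.eq_or_lt with rfl | hm
  · simpa using nonpos_of_forall_le_sq (by simpa using h)
  rcases hD.eq_or_lt with rfl | hD
  · exact absurd (by simpa using h) (not_forall_le_sub_log hN hm)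
  · exact le_log_of_forall_le_of_pos hN hm hD h

end Optimization

section Inequality

variable {n : ℕ} {α : ℝ} {w : (𝔼 n) → ℝ}

lemma ent_eq_entropy {ν : Measure (𝔼 n)} {φ : (𝔼 n) → ℝ}
    (h : Integrable (fun x => φ x * Real.log (φ x)) ν) : ent ν φ = (entropy ν φ : EReal) := by
  have hpos : entPos ν φ ≠ ⊤ := h.lintegral_lt_top.ne
  have hneg : entNeg ν φ ≠ ⊤ := h.neg.lintegral_lt_top.ne
  rw [ent, entropy, ← EReal.coe_ennreal_toReal hpos, ← EReal.coe_ennreal_toReal hneg,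
    ← EReal.coe_sub, ← EReal.coe_sub, integral_eq_lintegral_pos_part_sub_lintegral_neg_part h]
  rfl

namespace IsHomogeneousLogConcave

lemma homogeneousDim_pos (hw : IsHomogeneousLogConcave α w) (hn : 1 ≤ n) : 0 < (n : ℝ) + α :=
  add_pos_of_pos_of_nonneg (by exact_mod_cast hn) hw.degree_nonneg

lemma sharpConst_eq (hw : IsHomogeneousLogConcave α w) :
    sharpConst w α =
      4 / (n + α) * Real.exp (2 / (n + α) * Real.log (normConst w) - 1) := by
  rw [sharpConst, Real.rpow_def_of_pos hw.normConst_pos, Real.exp_sub, mul_comm (Real.log _)]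
  field_simp

lemma sharpConst_pos (hw : IsHomogeneousLogConcave α w) (hn : 1 ≤ n) : 0 < sharpConst w α := by
  have := hw.homogeneousDim_pos hn
  rw [hw.sharpConst_eq]
  positivity

theorem lsi_sharpConst (hw : IsHomogeneousLogConcave α w) (hn : 1 ≤ n) :
    LSI w α (sharpConst w α) := by
  intro f g hfg
  by_cases hneg : entNeg (nu w) (fun x => f x ^ 2) = ⊤
  · rw [ent, hneg, EReal.coe_ennreal_top, EReal.sub_top, EReal.bot_sub]
    exact bot_le
  have hint := hw.integrable_sq_mul_log_sq_of_entNeg_ne_top hfg hneg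
  rw [ent_eq_entropy hint, EReal.coe_le_coe_iff, lsiRHS, hw.sharpConst_eq]
  exact le_log_of_forall_le (hw.homogeneousDim_pos hn) (integral_nonneg fun x => sq_nonneg _)
    (integral_nonneg fun x => sq_nonneg _)
    fun t ht => hw.entropy_nu_sq_le_of_admissible hfg hint ht

end IsHomogeneousLogConcave

end Inequality

section SecondMoment

variable {n : ℕ} {α : ℝ} {w : (𝔼 n) → ℝ}

lemma mul_exp_neg_le {c : ℝ} (hc : 0 < c) (r : ℝ) :
    r * Real.exp (-c * r) ≤ 2 / c * Real.exp (-(c / 2) * r) := by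
  have hle : r ≤ 2 / c * Real.exp (c / 2 * r) := calc
    r = 2 / c * (c / 2 * r) := by field_simp
    _ ≤ 2 / c * Real.exp (c / 2 * r) := by
      gcongr
      exact (le_add_of_nonneg_right zero_le_one).trans (Real.add_one_le_exp _)
  calc r * Real.exp (-c * r)
      ≤ 2 / c * Real.exp (c / 2 * r) * Real.exp (-c * r) := by gcongr
    _ = 2 / c * Real.exp (-(c / 2) * r) := by
      rw [mul_assoc, ← Real.exp_add]
      ring_nf

lemma fderiv_exp_neg_norm_sq_apply {E : Type*} [NormedAddCommGroup E] [InnerProductSpace ℝ E]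
    [CompleteSpace E] (x y : E) :
    fderiv ℝ (fun x : E => Real.exp (-‖x‖ ^ 2 / 2)) x y
      = -(Real.exp (-‖x‖ ^ 2 / 2) * inner ℝ x y) := by
  have hexp : HasDerivAt (fun r : ℝ => Real.exp (-r / 2)) (Real.exp (-‖x‖ ^ 2 / 2) * (-1 / 2))
    (‖x‖ ^ 2) := ((hasDerivAt_id' _).neg.div_const 2).exp
  rw [(hasGradientAt_comp_norm_sq hexp).fderiv_apply, real_inner_smul_left]
  ring

lemma abs_fderiv_exp_neg_norm_sq_smul_apply_le {E : Type*} [NormedAddCommGroup E]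
    [InnerProductSpace ℝ E] [CompleteSpace E] (x : E) {t : ℝ}
    (ht : t ∈ Metric.ball (1 : ℝ) (1 / 2)) :
    |fderiv ℝ (fun x : E => Real.exp (-‖x‖ ^ 2 / 2)) (t • x) x|
      ≤ 3 / 2 * (‖x‖ ^ 2 * Real.exp (-(1 / 8) * ‖x‖ ^ 2)) := by
  rw [Metric.mem_ball, Real.dist_eq, abs_lt] at ht
  have ht_sq : 1 / 4 ≤ t ^ 2 := by nlinarith
  have hexp : Real.exp (-(t ^ 2 * ‖x‖ ^ 2) / 2) ≤ Real.exp (-(1 / 8) * ‖x‖ ^ 2) :=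
    Real.exp_le_exp.2 (by nlinarith [sq_nonneg ‖x‖])
  calc |fderiv ℝ (fun x : E => Real.exp (-‖x‖ ^ 2 / 2)) (t • x) x|
      = t * (‖x‖ ^ 2 * Real.exp (-(t ^ 2 * ‖x‖ ^ 2) / 2)) := by
        rw [fderiv_exp_neg_norm_sq_apply, abs_neg, real_inner_smul_left,
          real_inner_self_eq_norm_sq, norm_smul, mul_pow, Real.norm_eq_abs, sq_abs, abs_mul,
          abs_mul, Real.abs_exp, abs_of_pos (by linarith : 0 < t), abs_sq]
        ring
    _ ≤ 3 / 2 * (‖x‖ ^ 2 * Real.exp (-(1 / 8) * ‖x‖ ^ 2)) := by gcongr; linarith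

namespace IsHomogeneousLogConcave

lemma integrable_nu_norm_sq_mul_exp_neg (hw : IsHomogeneousLogConcave α w) {c : ℝ} (hc : 0 < c) :
    Integrable (fun x => ‖x‖ ^ 2 * Real.exp (-c * ‖x‖ ^ 2)) (nu w) :=
  hw.integrable_nu_of_le (by fun_prop) (half_pos hc) fun x => by
    rw [Real.norm_of_nonneg (by positivity)]
    exact mul_exp_neg_le hc _

lemma integrable_nu_norm_sq_mul_gauss (hw : IsHomogeneousLogConcave α w) :
    Integrable (fun x => ‖x‖ ^ 2 * Real.exp (-‖x‖ ^ 2 / 2)) (nu w) := by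
  convert hw.integrable_nu_norm_sq_mul_exp_neg one_half_pos using 4
  ring

lemma integral_nu_gauss (hw : IsHomogeneousLogConcave α w) :
    ∫ x, Real.exp (-‖x‖ ^ 2 / 2) ∂(nu w) = (normConst w)⁻¹ := by
  rw [hw.normConst_eq, inv_inv]

lemma integral_nu_norm_sq_mul_gauss (hw : IsHomogeneousLogConcave α w) :
    ∫ x, ‖x‖ ^ 2 * Real.exp (-‖x‖ ^ 2 / 2) ∂(nu w) = (n + α) * (normConst w)⁻¹ := by
  have hsmooth : ContDiff ℝ 1 fun x : 𝔼 n => Real.exp (-‖x‖ ^ 2 / 2) :=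
    ((contDiff_norm_sq ℝ).neg.div_const 2).exp
  have hparts := hw.integral_fderiv_apply_self hsmooth hw.integrable_nu_gauss
    ((hw.integrable_nu_norm_sq_mul_exp_neg (c := 1 / 8) (by norm_num)).const_mul (3 / 2))
    fun x t ht => abs_fderiv_exp_neg_norm_sq_smul_apply_le x ht
  simp_rw [fderiv_exp_neg_norm_sq_apply, real_inner_self_eq_norm_sq] at hparts
  rw [integral_neg, hw.integral_nu_gauss, neg_mul, neg_inj] at hparts
  simpa only [mul_comm (‖_‖ ^ 2)] using hparts

end IsHomogeneousLogConcave

end SecondMoment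

section Gaussian

variable {n : ℕ} {α : ℝ} {w : (𝔼 n) → ℝ}

lemma contDiff_gaussian (A : ℝ) : ContDiff ℝ ∞ (gaussian A : (𝔼 n) → ℝ) :=
  contDiff_const.mul ((contDiff_norm_sq ℝ).neg.div_const 4).exp

lemma gradient_gaussian (A : ℝ) (x : 𝔼 n) :
    gradient (gaussian A) x = (-(1 / 2) * gaussian A x) • x := by
  have hexp : HasDerivAt (fun r : ℝ => A * Real.exp (-r / 4))
      (A * (Real.exp (-‖x‖ ^ 2 / 4) * (-1 / 4))) (‖x‖ ^ 2) :=
    ((hasDerivAt_id' _).neg.div_const 4).exp.const_mul A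
  refine (hasGradientAt_comp_norm_sq hexp).gradient.trans ?_
  rw [gaussian]
  ring_nf

lemma gaussian_sq (A : ℝ) (x : 𝔼 n) : gaussian A x ^ 2 = A ^ 2 * Real.exp (-‖x‖ ^ 2 / 2) := by
  rw [gaussian, mul_pow, ← Real.exp_nat_mul]
  push_cast
  ring_nf

lemma norm_gradient_gaussian_sq (A : ℝ) (x : 𝔼 n) :
    ‖gradient (gaussian A) x‖ ^ 2 = A ^ 2 / 4 * (‖x‖ ^ 2 * Real.exp (-‖x‖ ^ 2 / 2)) := by
  rw [gradient_gaussian, norm_smul, mul_pow, Real.norm_eq_abs, sq_abs, mul_pow, gaussian_sq]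
  ring

lemma gaussian_sq_mul_log (A : ℝ) (x : 𝔼 n) :
    gaussian A x ^ 2 * Real.log (gaussian A x ^ 2) =
      A ^ 2 * Real.log (A ^ 2) * Real.exp (-‖x‖ ^ 2 / 2)
        - A ^ 2 / 2 * (‖x‖ ^ 2 * Real.exp (-‖x‖ ^ 2 / 2)) := by
  rw [gaussian_sq]
  rcases eq_or_ne A 0 with rfl | hA
  · simp
  · rw [Real.log_mul (by positivity) (Real.exp_ne_zero _), Real.log_exp]
    ring

namespace IsHomogeneousLogConcave

lemma memLp_gaussian (hw : IsHomogeneousLogConcave α w) (A : ℝ) :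
    MemLp (gaussian A) 2 (nu w) := by
  rw [memLp_two_iff_integrable_sq (contDiff_gaussian A).continuous.aestronglyMeasurable]
  simp_rw [gaussian_sq]
  exact hw.integrable_nu_gauss.const_mul _

lemma memLp_gradient_gaussian (hw : IsHomogeneousLogConcave α w) (A : ℝ) :
    MemLp (gradient (gaussian A)) 2 (nu w) := by
  rw [memLp_two_iff_integrable_sq_norm
    (continuous_gradient (contDiff_infty.1 (contDiff_gaussian A) 1)).aestronglyMeasurable]
  simp_rw [norm_gradient_gaussian_sq]
  exact hw.integrable_nu_norm_sq_mul_gauss.const_mul _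

lemma mu_le_smul_nu (hw : IsHomogeneousLogConcave α w) :
    mu w ≤ ENNReal.ofReal (normConst w) • nu w := by
  rw [hw.mu_eq_withDensity_nu, ← withDensity_const]
  refine withDensity_mono (ae_of_all _ fun x => ENNReal.ofReal_le_ofReal ?_)
  refine mul_le_of_le_one_right hw.normConst_pos.le (Real.exp_le_one_iff.2 ?_)
  linarith [sq_nonneg ‖x‖]

/-- A boundary point `x` of the cone stays in the closed cone under dilations, so a normal at `x`
has nonpositive inner product with both `x` and `-x`. -/
lemma inner_eq_zero_of_isOutwardNormal (hw : IsHomogeneousLogConcave α w) {x η : 𝔼 n}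
    (hx : x ∈ frontier (support w)) (hη : IsOutwardNormal (support w) x η) :
    inner ℝ x η = 0 := by
  have hclosure : ∀ y ∈ closure (support w), inner ℝ η (y - x) ≤ 0 := fun y hy =>
    closure_minimal (t := {y | inner ℝ η (y - x) ≤ 0}) hη
      (isClosed_le (by fun_prop) continuous_const) hy
  have hdilate (t : ℝ) (ht : 0 < t) : inner ℝ η (t • x - x) ≤ 0 :=
    hclosure _ (map_mem_closure (continuous_const_smul t) (frontier_subset_closure hx)
      fun y hy => hw.smul_mem_support ht hy)
  have hdouble := hdilate 2 two_pos
  have hhalf := hdilate (1 / 2) one_half_pos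
  rw [inner_sub_right, real_inner_smul_right] at hdouble hhalf
  rw [real_inner_comm]
  linarith

lemma isTestFunction_cutoff_mul_gaussian (hw : IsHomogeneousLogConcave α w) (A : ℝ) {R : ℝ}
    (hR : 0 < R) : IsTestFunction w fun x => cutoff R x * gaussian A x := by
  refine ⟨(contDiff_cutoff R).mul (contDiff_gaussian A), (hasCompactSupport_cutoff hR).mul_right,
    fun x hx η hη => ?_⟩
  set ψ : ℝ → ℝ := fun r =>
    Real.smoothTransition (2 - R⁻¹ ^ 2 * r) * (A * Real.exp (-r / 4))
  have hψ : ContDiff ℝ 1 ψ :=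
    ((Real.smoothTransition.contDiff (n := 1)).comp (by fun_prop)).mul (by fun_prop)
  have hradial : (fun x : 𝔼 n => cutoff R x * gaussian A x) = fun x => ψ (‖x‖ ^ 2) := by
    ext x
    simp only [cutoff, gaussian, ψ, norm_smul, mul_pow, Real.norm_eq_abs, sq_abs]
  rw [hradial, (hasGradientAt_comp_norm_sq (hψ.differentiable (by simp) _).hasDerivAt).gradient,
    real_inner_smul_left, hw.inner_eq_zero_of_isOutwardNormal hx hη, mul_zero]

lemma admissible_gaussian (hw : IsHomogeneousLogConcave α w) (A : ℝ) :
    Admissible w (gaussian A) (gradient (gaussian A)) := by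
  have hf := hw.memLp_gaussian A
  have hg := hw.memLp_gradient_gaussian A
  have hf_mu := hf.of_measure_le_smul ENNReal.ofReal_ne_top hw.mu_le_smul_nu
  have hg_mu := hg.of_measure_le_smul ENNReal.ofReal_ne_top hw.mu_le_smul_nu
  refine ⟨⟨hf_mu, hg_mu, fun k x => cutoff (k + 1 : ℝ) x * gaussian A x,
    fun k => hw.isTestFunction_cutoff_mul_gaussian A (by positivity), ?_⟩, hf, hg⟩
  simp_rw [gradient_cutoff_mul _ ((contDiff_gaussian (n := n) A).differentiable (by simp))]
  simpa only [add_zero] using (tendsto_eLpNorm_cutoff_mul_sub hf_mu).add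
    (tendsto_eLpNorm_cutoffGradient_sub hf_mu hg_mu)

lemma integral_gaussian_sq (hw : IsHomogeneousLogConcave α w) (A : ℝ) :
    ∫ x, gaussian A x ^ 2 ∂(nu w) = A ^ 2 * (normConst w)⁻¹ := by
  simp_rw [gaussian_sq]
  rw [integral_const_mul, hw.integral_nu_gauss]

lemma integral_norm_gradient_gaussian_sq (hw : IsHomogeneousLogConcave α w) (A : ℝ) :
    ∫ x, ‖gradient (gaussian A) x‖ ^ 2 ∂(nu w) = A ^ 2 / 4 * ((n + α) * (normConst w)⁻¹) := by
  simp_rw [norm_gradient_gaussian_sq]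
  rw [integral_const_mul, hw.integral_nu_norm_sq_mul_gauss]

lemma integrable_gaussian_sq_mul_log (hw : IsHomogeneousLogConcave α w) (A : ℝ) :
    Integrable (fun x => gaussian A x ^ 2 * Real.log (gaussian A x ^ 2)) (nu w) := by
  simp_rw [gaussian_sq_mul_log]
  exact (hw.integrable_nu_gauss.const_mul _).sub (hw.integrable_nu_norm_sq_mul_gauss.const_mul _)

lemma entropy_gaussian_sq (hw : IsHomogeneousLogConcave α w) (A : ℝ) :
    entropy (nu w) (fun x => gaussian A x ^ 2) =
      A ^ 2 * (normConst w)⁻¹ * (Real.log (normConst w) - (n + α) / 2) := by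
  have hC := hw.normConst_pos
  rw [entropy, hw.integral_gaussian_sq]
  simp_rw [gaussian_sq_mul_log]
  rw [integral_sub (hw.integrable_nu_gauss.const_mul _)
    (hw.integrable_nu_norm_sq_mul_gauss.const_mul _), integral_const_mul, integral_const_mul,
    hw.integral_nu_norm_sq_mul_gauss, hw.integral_nu_gauss]
  rcases eq_or_ne A 0 with rfl | hA
  · simp
  · rw [Real.log_mul (by positivity) (by positivity), Real.log_inv]
    ring

lemma lsiRHS_gaussian (hw : IsHomogeneousLogConcave α w) (A C : ℝ) :
    lsiRHS w α C (gaussian A) (gradient (gaussian A)) =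
      (n + α) / 2 * (A ^ 2 * (normConst w)⁻¹) * Real.log (C * ((n + α) / 4)) := by
  rw [lsiRHS, hw.integral_gaussian_sq, hw.integral_norm_gradient_gaussian_sq]
  rcases eq_or_ne A 0 with rfl | hA
  · simp
  · have := hw.normConst_pos.ne'
    congr 3
    field_simp

theorem ent_gaussian_sq (hw : IsHomogeneousLogConcave α w) (hn : 1 ≤ n) (A : ℝ) :
    ent (nu w) (fun x => gaussian A x ^ 2) =
      (lsiRHS w α (sharpConst w α) (gaussian A) (gradient (gaussian A)) : EReal) := by
  have hN := hw.homogeneousDim_pos hn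
  have hlog : Real.log (sharpConst w α * ((n + α) / 4)) =
      2 / (n + α) * Real.log (normConst w) - 1 := by
    rw [hw.sharpConst_eq, mul_right_comm, div_mul_div_cancel₀ hN.ne', div_self four_ne_zero,
      one_mul, Real.log_exp]
  rw [ent_eq_entropy (hw.integrable_gaussian_sq_mul_log A), hw.entropy_gaussian_sq,
    hw.lsiRHS_gaussian, hlog, EReal.coe_eq_coe_iff]
  field_simp

theorem sharpConst_le (hw : IsHomogeneousLogConcave α w) (hn : 1 ≤ n) {C : ℝ} (hC : 0 < C)
    (h : LSI w α C) : sharpConst w α ≤ C := by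
  have hN := hw.homogeneousDim_pos hn
  have hnormConst := hw.normConst_pos
  have hsharp := hw.sharpConst_pos hn
  have hle := h _ _ (hw.admissible_gaussian 1)
  rw [hw.ent_gaussian_sq hn, EReal.coe_le_coe_iff, hw.lsiRHS_gaussian, hw.lsiRHS_gaussian] at hle
  have hlog := le_of_mul_le_mul_left hle (by positivity)
  rw [Real.log_le_log_iff (by positivity) (by positivity)] at hlog
  exact le_of_mul_le_mul_right hlog (by positivity)

end IsHomogeneousLogConcave

end Gaussian

end WeightedLSI

end

/-- The sharp logarithmic Sobolev inequality for log-concave homogeneous weights. The three parts: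
`Ent_ν(f²)` is well defined in `[-∞, ∞)`; `C_LSIH` is the least constant for which the inequality
holds; Gaussians are admissible and give equality. -/
theorem theorem1p9 (n : ℕ) (hn : 1 ≤ n) (α : ℝ) (w : EuclideanSpace ℝ (Fin n) → ℝ)
    (hw : WeightedLSI.IsHomogeneousLogConcave α w) :
    (∀ (f : EuclideanSpace ℝ (Fin n) → ℝ)
        (g : EuclideanSpace ℝ (Fin n) → EuclideanSpace ℝ (Fin n)),
      WeightedLSI.Admissible w f g →
        WeightedLSI.entPos (WeightedLSI.nu w) (fun x => f x ^ 2) < ⊤) ∧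
    IsLeast {C : ℝ | 0 < C ∧ WeightedLSI.LSI w α C} (WeightedLSI.sharpConst w α) ∧
    (∀ A : ℝ,
      WeightedLSI.Admissible w (WeightedLSI.gaussian A) (gradient (WeightedLSI.gaussian A)) ∧
      WeightedLSI.ent (WeightedLSI.nu w) (fun x => WeightedLSI.gaussian A x ^ 2) =
        ((WeightedLSI.lsiRHS w α (WeightedLSI.sharpConst w α) (WeightedLSI.gaussian A)
          (gradient (WeightedLSI.gaussian A)) : ℝ) : EReal)) := by
  exact ⟨fun f g hfg => hw.entPos_nu_sq_lt_top hfg,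
    ⟨⟨hw.sharpConst_pos hn, hw.lsi_sharpConst hn⟩, fun C hC => hw.sharpConst_le hn hC.1 hC.2⟩,
    fun A => ⟨hw.admissible_gaussian A, hw.ent_gaussian_sq hn A⟩⟩
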